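/- **Setting.** Let $q\ge 1$ be an integer, $\Gamma_0(q)\subseteq \mathrm{Sp}(4,\mathbb Z)$ the subgroup of matrices whose lower left $2\times2$ block is divisible by $q$, and $K=\mathrm{SO}(4)\cap \mathrm{Sp}(4,\mathbb R)$. Let $U$ be the group of matrices $$x=\begin{pmatrix}1&x_{12}&x_{13}&x_{14}\\&1&x_{23}&x_{24}\\&&1&\\&&-x_{12}&1\end{pmatrix},\qquad x_{14}=x_{23}+x_{12}x_{24},$$ and put $\theta_M(x)=e^{2\pi i(M_1x_{12}+M_2x_{24})}$ for $M=(M_1,M_2)\in\mathbb N^2$, $\iota(y)=\mathrm{diag}(y_1y_2^{1/2},\,y_2^{1/2},\,y_1^{-1}y_2^{-1/2},\,y_2^{-1/2})$ for $y\in\mathbb R_{>0}^2$, and $M^\eta=M_1^2M_2^{3/2}$. Let $\varpi_1:\mathrm{Sp}(4,\mathbb R)\to\mathbb C$ be a right $K$-invariant cuspidal automorphic form for $\Gamma_0(q)$ with archimedean spectral parameter $\mu=(\mu_1,\mu_2)\in\mathbb C^2$ (it is a joint eigenfunction of the invariant differential operators on $\mathrm{Sp}(4,\mathbb R)/K$,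 with the same eigenvalues as $x\,\iota(y)k\mapsto y_1^{2+\mu_1+\mu_2}y_2^{3/2+\mu_1}$). For $m$ coprime to $q$ let $$T(m)\varpi_1(g)=\sum_{h}\varpi_1(m^{-1/2}hg),$$ where $h$ runs over representatives of the left cosets $\Gamma_0(q)h$ in the set of integral matrices $h$ with $h^\top Jh=mJ$, $J=\begin{pmatrix}&I_2\\-I_2&\end{pmatrix}$, whose lower left $2\times 2$ block is divisible by $q$. Assume that $\varpi_1$ is an eigenfunction of $T(m)$, with eigenvalue $\lambda(m,\pi)$, for every $m\ge1$ coprime to $q$. This holds in particular if $\varpi_1$ is a cuspidal newform of level dividing $q$ in an irreducible automorphic representation $\pi$ of $\mathrm{GSp}(4)$ with trivial central character. For $M\in\mathbb N^2$ the Fourier coefficient $A(M)=A_{\varpi_1}(M)\in\mathbb C$ is the constant determined by $$\int_{U(\mathbb Z)\backslash U(\mathbb R)}\varpi_1(ug)\,\overline{\theta_M(u)}\,du=\frac{A(M)}{M^\eta}\,\theta_M(x)\,W_\mu(M_1y_1,M_2y_2)\qquad(g=x\,\iota(y)k),$$ where $W_\mu$ is the standard Whittaker function on $\mathrm{Sp}(4,\mathbb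 R)$ with parameter $\mu$ for the character $\theta_{(1,1)}$. **Theorem.** Suppose that $A(1,1)=1$ (so that $\varpi_1$ is generic), and let $p\nmid q$ be a prime. Then $$\lambda(p,\pi)=p^{3/2}A(1,p),\qquad \lambda(p^r,\pi)=p^{3r/2}\bigl(A(1,p^r)-p^{-1}A(1,p^{r-2})\bigr)\quad\text{for all } r\ge2.$$ -/

import Mathlib

open scoped Matrix
open Matrix

noncomputable section

namespace SiegelHecke

/-! ### The group `Sp(4, ℝ)` and its subgroups -/

/-- `Sp(4, ℝ)`, in `2 × 2` block form, for the standard alternating form. -/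
abbrev Sp4 : Type := Matrix.symplecticGroup (Fin 2) ℝ

/-- `Sp(4, ℤ)`. -/
abbrev Sp4Z : Type := Matrix.symplecticGroup (Fin 2) ℤ

/-- Integral `4 × 4` matrices in `2 × 2` block form. -/
abbrev MatZ : Type := Matrix (Fin 2 ⊕ Fin 2) (Fin 2 ⊕ Fin 2) ℤ

/-- The lower left `2 × 2` block of `N` is divisible by `q`. -/
def LowerLeftDvd (q : ℕ) (N : MatZ) : Prop :=
  ∀ i j : Fin 2, (q : ℤ) ∣ N (Sum.inr i) (Sum.inl j)

/-- `Γ₀(q)`: the matrices in `Sp(4, ℤ)` whose lower left `2 × 2` block is divisible by `q`. -/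
def Gamma0 (q : ℕ) : Subgroup Sp4Z where
  carrier := {γ | LowerLeftDvd q γ.1}
  one_mem' := by
    intro i j
    simp
  mul_mem' := by
    intro a b ha hb i j
    change (q : ℤ) ∣ (a.1 * b.1) (Sum.inr i) (Sum.inl j)
    rw [Matrix.mul_apply, Fintype.sum_sum_type]
    exact dvd_add (Finset.dvd_sum fun l _ => Dvd.dvd.mul_right (ha i l) _)
      (Finset.dvd_sum fun l _ => Dvd.dvd.mul_left (hb l j) _)
  inv_mem' := by
    intro a ha i j
    have h : (a⁻¹).1 (Sum.inr i) (Sum.inl j) = - a.1 (Sum.inr j) (Sum.inl i) := by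
      rw [SymplecticGroup.coe_inv, Matrix.J]
      fin_cases i <;> fin_cases j <;>
        simp [Matrix.mul_apply, Fintype.sum_sum_type, Matrix.fromBlocks, Matrix.one_apply]
    rw [h]
    exact (dvd_neg).2 (ha j i)

/-- The inclusion of `Sp(4, ℤ)` in `Sp(4, ℝ)`. -/
def toReal (γ : Sp4Z) : Sp4 :=
  ⟨γ.1.map (Int.castRingHom ℝ), SymplecticGroup.map_mem γ.2 (Int.castRingHom ℝ)⟩

/-- The maximal compact subgroup `K` of orthogonal matrices in `Sp(4, ℝ)`
(symplectic matrices have determinant one). -/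
def K : Set Sp4 := {k | k.1 * k.1ᵀ = 1}

/-- The element of the unipotent group `U(ℝ)` with coordinates `x₁₂, x₁₃, x₂₃, x₂₄`. -/
def unip (x₁₂ x₁₃ x₂₃ x₂₄ : ℝ) : Sp4 :=
  ⟨Matrix.fromBlocks !![1, x₁₂; 0, 1] !![x₁₃, x₂₃ + x₁₂ * x₂₄; x₂₃, x₂₄] 0 !![1, 0; -x₁₂, 1], by
    rw [SymplecticGroup.mem_iff, Matrix.J, Matrix.fromBlocks_transpose,
      Matrix.fromBlocks_multiply, Matrix.fromBlocks_multiply]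
    congr 1 <;> ext i j <;> fin_cases i <;> fin_cases j <;>
      simp [Matrix.vecMul, dotProduct, Fin.sum_univ_two] <;> ring⟩

/-- `ι(y₁, y₂) = diag(y₁ y₂^{1/2}, y₂^{1/2}, y₁⁻¹ y₂^{-1/2}, y₂^{-1/2})` for `y₁, y₂ > 0`
(and the identity otherwise; only positive arguments are ever used). -/
def iota (y₁ y₂ : ℝ) : Sp4 :=
  if h : 0 < y₁ ∧ 0 < y₂ then
    ⟨Matrix.fromBlocks (Matrix.diagonal ![y₁ * √y₂, √y₂]) 0 0
        (Matrix.diagonal ![(y₁ * √y₂)⁻¹, (√y₂)⁻¹]), by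
      have h1 : y₁ ≠ 0 := h.1.ne'
      have h2 : √y₂ ≠ 0 := (Real.sqrt_pos.2 h.2).ne'
      rw [SymplecticGroup.mem_iff, Matrix.J, Matrix.fromBlocks_transpose,
        Matrix.fromBlocks_multiply, Matrix.fromBlocks_multiply]
      congr 1 <;> ext i j <;> fin_cases i <;> fin_cases j <;> simp <;> field_simp⟩
  else 1

/-- Integration over `Sp(4, ℝ) / K` of a right `K`-invariant function against the left invariant
measure `dx d*y`, where `d*y = y₁⁻⁴ y₂⁻³ (dy₁ / y₁) (dy₂ / y₂)`. -/
def integralModK (f : Sp4 → ℂ) : ℂ :=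
  ∫ x : Fin 4 → ℝ, ∫ y₁ in Set.Ioi (0 : ℝ), ∫ y₂ in Set.Ioi (0 : ℝ),
    f (unip (x 0) (x 1) (x 2) (x 3) * iota y₁ y₂) * ((y₁ ^ 5 * y₂ ^ 4)⁻¹ : ℝ)

/-! ### Hecke operators -/

/-- The integral symplectic similitudes with multiplier `m > 0` whose lower left block is divisible
by `q`. For `q = 1` this is the set of all integral similitudes with multiplier `m`. -/
def simil (q m : ℕ) : Set MatZ :=
  {N | 0 < m ∧ Nᵀ * Matrix.J (Fin 2) ℤ * N = (m : ℤ) • Matrix.J (Fin 2) ℤ ∧ LowerLeftDvd q N}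

/-- The relation `Γ₀(q) N = Γ₀(q) N'` on the similitudes. -/
def cosetSetoid (q m : ℕ) : Setoid (simil q m) where
  r N N' := ∃ γ ∈ Gamma0 q, N'.1 = γ.1 * N.1
  iseqv :=
    { refl := fun N => ⟨1, one_mem _, by simp⟩
      symm := by
        rintro N N' ⟨γ, hγ, h⟩
        refine ⟨γ⁻¹, inv_mem hγ, ?_⟩
        rw [h, ← Matrix.mul_assoc, ← Submonoid.coe_mul, inv_mul_cancel]
        simp
      trans := by
        rintro N N' N'' ⟨γ, hγ, h⟩ ⟨δ, hδ, h'⟩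
        exact ⟨δ * γ, mul_mem hδ hγ, by rw [h', h, Submonoid.coe_mul, Matrix.mul_assoc]⟩ }

/-- The image `m^{-1/2} N` in `Sp(4, ℝ)` of a similitude with multiplier `m`: this is how
`GSp(4, ℚ)⁺` acts when the centre acts trivially. -/
def normalize {q m : ℕ} (N : simil q m) : Sp4 :=
  ⟨(√(m : ℝ))⁻¹ • N.1.map (Int.castRingHom ℝ), by
    have hm : (0 : ℝ) < m := by exact_mod_cast N.2.1
    have h := congrArg (fun A : MatZ => A.map (Int.castRingHom ℝ)) N.2.2.1
    simp only [Matrix.map_mul, Matrix.map_J] at h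
    have h2 : ((m : ℤ) • Matrix.J (Fin 2) ℤ).map (Int.castRingHom ℝ)
        = (m : ℝ) • Matrix.J (Fin 2) ℝ := by
      rw [← Matrix.map_J (Fin 2) (Int.castRingHom ℝ)]
      ext i j
      rw [Matrix.map_apply, Matrix.smul_apply, Matrix.smul_apply, Matrix.map_apply]
      simp [-Matrix.map_J]
    rw [h2, Matrix.transpose_map] at h
    rw [SymplecticGroup.mem_iff', Matrix.transpose_smul, Matrix.smul_mul, Matrix.smul_mul,
      Matrix.mul_smul, h, smul_smul, smul_smul]
    have : (√(m : ℝ))⁻¹ * ((√(m : ℝ))⁻¹ * m) = 1 := by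
      have hs : √(m : ℝ) ≠ 0 := (Real.sqrt_pos.2 hm).ne'
      have := Real.mul_self_sqrt hm.le
      field_simp
      nlinarith
    rw [← mul_assoc] at this
    simp [this]⟩

/-- The `m`-th standard Hecke operator at level `q`:
`T(m) ϖ (g) = ∑ ϖ(h g)`, with `h` over representatives of `Γ₀(q) \ simil q m`. -/
def heckeOperator (q m : ℕ) (ϖ : Sp4 → ℂ) (g : Sp4) : ℂ :=
  ∑ᶠ c : Quotient (cosetSetoid q m), ϖ (normalize c.out * g)

/-- The eigenvalue of `T(m)` on a (nonzero) eigenfunction. -/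
def heckeEigenvalue (q m : ℕ) (ϖ : Sp4 → ℂ) : ℂ :=
  Classical.epsilon fun c : ℂ => ∀ g, heckeOperator q m ϖ g = c * ϖ g

/-! ### Cuspidal eigenforms -/

/-- `ϖ` has archimedean spectral parameter `(μ₁, μ₂)`: it is an eigenfunction of right convolution
by every continuous compactly supported bi-`K`-invariant function `φ`, with the same eigenvalue as
the spherical vector `x ι(y) k ↦ y₁^{2 + μ₁ + μ₂} y₂^{3/2 + μ₁}` of the principal series induced
from `diag(t₁, t₂, t₁⁻¹, t₂⁻¹) ↦ t₁^{μ₁ + μ₂} t₂^{μ₁ - μ₂}`. This is the same as being smooth and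
a joint eigenfunction of all invariant differential operators on `Sp(4, ℝ) / K` with the
eigenvalues given by `(μ₁, μ₂)`. -/
def HasSpectralParameter (μ₁ μ₂ : ℂ) (ϖ : Sp4 → ℂ) : Prop :=
  ∀ φ : Sp4 → ℂ, Continuous φ → HasCompactSupport φ →
    (∀ g, ∀ k ∈ K, ∀ k' ∈ K, φ (k * g * k') = φ g) →
    ∀ g : Sp4, integralModK (fun h => ϖ (g * h) * φ h) =
      (∫ x : Fin 4 → ℝ, ∫ y₁ in Set.Ioi (0 : ℝ), ∫ y₂ in Set.Ioi (0 : ℝ),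
        φ (unip (x 0) (x 1) (x 2) (x 3) * iota y₁ y₂) *
          ((y₁ : ℂ) ^ (2 + μ₁ + μ₂) * (y₂ : ℂ) ^ (3 / 2 + μ₁)) *
          ((y₁ ^ 5 * y₂ ^ 4)⁻¹ : ℝ)) * ϖ g

/-- `ϖ` is a right `K`-invariant cuspidal automorphic form for `Γ₀(q)`, with archimedean spectral
parameter `(μ₁, μ₂)`, which is an eigenfunction of `T(m)` for all `m` coprime to `q`. Every right `K`-invariant vector of
level dividing `q` in an irreducible cuspidal automorphic representation with trivial central
character is of this kind, in particular every cuspidal newform of level dividing `q`. -/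
structure IsCuspidalEigenform (q : ℕ) (μ₁ μ₂ : ℂ) (ϖ : Sp4 → ℂ) : Prop where
  continuous : Continuous ϖ
  left_invariant : ∀ γ ∈ Gamma0 q, ∀ g, ϖ (toReal γ * g) = ϖ g
  right_invariant : ∀ g, ∀ k ∈ K, ϖ (g * k) = ϖ g
  spectral : HasSpectralParameter μ₁ μ₂ ϖ
  moderate_growth : ∃ (C : ℝ) (n : ℕ), ∀ g : Sp4,
    ‖ϖ g‖ ≤ C * (1 + ∑ i, ∑ j, (g.1 i j) ^ 2) ^ n
  /-- The constant terms along the unipotent radical of the Siegel parabolic vanish at all cusps.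
  The integral is over a period, because `Γ₀(q)` contains the principal congruence subgroup of
  level `q`, which is normal in `Sp(4, ℤ)`. -/
  cuspidal_siegel : ∀ (γ : Sp4Z) (g : Sp4),
    ∫ x₁₃ in (0 : ℝ)..q, ∫ x₂₃ in (0 : ℝ)..q, ∫ x₂₄ in (0 : ℝ)..q,
      ϖ (toReal γ * unip 0 x₁₃ x₂₃ x₂₄ * g) = 0
  /-- The same for the Klingen parabolic. -/
  cuspidal_klingen : ∀ (γ : Sp4Z) (g : Sp4),
    ∫ x₁₂ in (0 : ℝ)..q, ∫ x₂₃ in (0 : ℝ)..q, ∫ x₁₃ in (0 : ℝ)..q,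
      ϖ (toReal γ * unip x₁₂ x₁₃ x₂₃ 0 * g) = 0
  hecke : ∀ m : ℕ, 0 < m → m.Coprime q →
    ∃ c : ℂ, ∀ g, heckeOperator q m ϖ g = c * ϖ g

/-! ### Whittaker functions and Fourier coefficients -/

/-- The character `θ_M(x) = e(M₁ x₁₂ + M₂ x₂₄)` of `U(ℝ)`, where `e(t) = exp(2πit)`. -/
def theta (M₁ M₂ : ℕ) (x₁₂ x₂₄ : ℝ) : ℂ :=
  Complex.exp (2 * Real.pi * Complex.I * (M₁ * x₁₂ + M₂ * x₂₄))

/-- `ϖ_M(g)`, the integral of `ϖ(xg)` against the conjugate of `θ_M(x)` over `U(ℤ) \ U(ℝ)`, for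
which the unit cube is a fundamental domain. -/
def whittakerIntegral (ϖ : Sp4 → ℂ) (M₁ M₂ : ℕ) (g : Sp4) : ℂ :=
  ∫ x₁₂ in (0 : ℝ)..1, ∫ x₂₄ in (0 : ℝ)..1, ∫ x₂₃ in (0 : ℝ)..1, ∫ x₁₃ in (0 : ℝ)..1,
    ϖ (unip x₁₂ x₁₃ x₂₃ x₂₄ * g) * (starRingEnd ℂ) (theta M₁ M₂ x₁₂ x₂₄)

/-- The hypergeometric value `₃F₂(a, b, c; d, e; 1)`. -/
def hyp3F2 (a b c d e : ℂ) : ℂ :=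
  ∑' n : ℕ, (ascPochhammer ℂ n).eval a * (ascPochhammer ℂ n).eval b * (ascPochhammer ℂ n).eval c /
    ((ascPochhammer ℂ n).eval d * (ascPochhammer ℂ n).eval e * (n.factorial : ℂ))

/-- The Mellin transform, in the variables `π y₁, π y₂`, of `y₁⁻² y₂^{-3/2} W_μ(y₁, y₂)`. -/
def whittakerMellin (μ₁ μ₂ s₁ s₂ : ℂ) : ℂ :=
  (2 : ℂ)⁻¹ ^ 4 *
    (Complex.Gamma ((s₁ + μ₁ + μ₂) / 2) * Complex.Gamma ((s₁ + μ₁ - μ₂) / 2) *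
      Complex.Gamma ((s₁ - μ₁ + μ₂) / 2) * Complex.Gamma ((s₁ - μ₁ - μ₂) / 2)) *
    (Complex.Gamma ((s₂ + μ₁) / 2) * Complex.Gamma ((s₂ - μ₁) / 2) *
      Complex.Gamma ((s₂ + μ₂) / 2) * Complex.Gamma ((s₂ - μ₂) / 2)) /
    (Complex.Gamma ((s₁ + s₂ + μ₁) / 2) * Complex.Gamma ((s₁ + s₂ - μ₁) / 2)) *
    hyp3F2 (s₁ / 2) ((s₂ + μ₂) / 2) ((s₂ - μ₂) / 2) ((s₁ + s₂ + μ₁) / 2) ((s₁ + s₂ - μ₁) / 2)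

/-- The standard Whittaker function `W_μ` on `Sp(4, ℝ)` in the coordinates `y₁, y₂ > 0`, for the
character `e(x₁₂ + x₂₄)`, as an inverse Mellin transform. The two contours are the vertical lines
with real part `1 + |Re μ₁| + |Re μ₂|`, to the right of all poles. -/
def whittaker (μ₁ μ₂ : ℂ) (y₁ y₂ : ℝ) : ℂ :=
  let σ : ℝ := 1 + |μ₁.re| + |μ₂.re|
  ((y₁ ^ 2 * y₂ ^ (3 / 2 : ℝ) : ℝ) : ℂ) * ((2 * Real.pi : ℂ) ^ 2)⁻¹ *
    ∫ t₁ : ℝ, ∫ t₂ : ℝ,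
      whittakerMellin μ₁ μ₂ (σ + t₁ * Complex.I) (σ + t₂ * Complex.I) *
        ((Real.pi * y₁ : ℝ) : ℂ) ^ (-(σ + t₁ * Complex.I)) *
        ((Real.pi * y₂ : ℝ) : ℂ) ^ (-(σ + t₂ * Complex.I))

/-- The relation that defines the `M`-th Fourier coefficient `a` of `ϖ`:
`ϖ_M(x ι(y) k) = a M^{-η} θ_M(x) W_μ(M₁ y₁, M₂ y₂)`, where `M^η = M₁² M₂^{3/2}`. -/
def IsFourierCoeff (μ₁ μ₂ : ℂ) (ϖ : Sp4 → ℂ) (M₁ M₂ : ℕ) (a : ℂ) : Prop :=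
  ∀ x₁₂ x₁₃ x₂₃ x₂₄ y₁ y₂ : ℝ, 0 < y₁ → 0 < y₂ → ∀ k ∈ K,
    whittakerIntegral ϖ M₁ M₂ (unip x₁₂ x₁₃ x₂₃ x₂₄ * iota y₁ y₂ * k) =
      a / (((M₁ : ℝ) ^ 2 * (M₂ : ℝ) ^ (3 / 2 : ℝ) : ℝ) : ℂ) * theta M₁ M₂ x₁₂ x₂₄ *
        whittaker μ₁ μ₂ (M₁ * y₁) (M₂ * y₂)

open Classical in
/-- The Fourier coefficient `A_ϖ(M₁, M₂)` for positive `M₁, M₂`: the unique constant in the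
defining relation (with the value `0` if there were no such constant, or more than one). -/
def fourierCoeff (μ₁ μ₂ : ℂ) (ϖ : Sp4 → ℂ) (M₁ M₂ : ℕ) : ℂ :=
  if h : ∃! a : ℂ, IsFourierCoeff μ₁ μ₂ ϖ M₁ M₂ a then h.choose else 0

end SiegelHecke

end

noncomputable section

namespace SiegelHecke

/-! The eigenvalue is read off by computing the (1,1) Whittaker integral of `T(m)ϖ` in two ways. The
eigenvalue equation gives `λ(m)` times that of `ϖ`. For the other evaluation, choose upper
triangular representatives of the Hecke cosets, with diagonal `(t₁, t₂, m/t₁, m/t₂)`; Γ₀(q) suffices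
for this because `m` is coprime to `q`. Moving such a representative past `unip` dilates and
translates the four coordinates, and they can be integrated in the order x₁₃, x₂₃, x₂₄, x₁₂.

The first two integrals only count representatives. Those over x₂₄ and x₁₂ test a function with a
small period against a character, and vanish unless `t₁ = t₂ = t` and the entry `k` is coprime to
`t` (`UInvariant.integral_repSum`); then `t² ∣ m`. The sum of `e(k/t)` over these `k` is a Ramanujan
sum: 1 for `t = 1`, -1 for `t = p`, 0 for higher powers of `p`. Hence for `m = p^r` at most two
terms survive: `ϖ_{(1,p^r)}` and, if `r ≥ 2`, `ϖ_{(1,p^{r-2})}`.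

Substituting `ι(1, m) g` for `g` removes the torus shift from the main term and expresses
`ϖ_{(1,p^r)}` through `ϖ_{(1,1)}` and `ϖ_{(1,p^{r-2})}`. By induction every `ϖ_{(1,p^r)}` is a
multiple of the standard Whittaker function, so multiplicity one is not needed, and comparing the
multiples gives the formulas. -/

/-! ### Coordinates on the Borel subgroup. -/

theorem unip_mul (a b c d a' b' c' d' : ℝ) :
    unip a b c d * unip a' b' c' d' =
      unip (a + a') (b + b' + a * c' - c * a' - a * d * a') (c + c' - d * a') (d + d') := by
  apply Subtype.ext
  simp only [unip, Submonoid.coe_mul]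
  rw [Matrix.fromBlocks_multiply]
  congr 1 <;> ext i j <;> fin_cases i <;> fin_cases j <;>
    simp <;> ring

theorem iota_mul_unip (y₁ y₂ a b c d : ℝ) (h₁ : 0 < y₁) (h₂ : 0 < y₂) :
    iota y₁ y₂ * unip a b c d =
      unip (y₁ * a) (y₁ ^ 2 * y₂ * b) (y₁ * y₂ * c) (y₂ * d) * iota y₁ y₂ := by
  apply Subtype.ext
  have h3 : √y₂ ≠ 0 := (Real.sqrt_pos.2 h₂).ne'
  have h4 : y₁ ≠ 0 := h₁.ne'
  have h5 : y₂ = √y₂ ^ 2 := (Real.sq_sqrt h₂.le).symm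
  simp only [iota, h₁, h₂, and_self, dif_pos, unip, Submonoid.coe_mul]
  rw [Matrix.fromBlocks_multiply, Matrix.fromBlocks_multiply]
  -- With `s = √y₂` as variable all entries become rational functions.
  generalize √y₂ = s at *
  subst h5
  congr 1 <;> ext i j <;> fin_cases i <;> fin_cases j <;>
    simp [Matrix.vecMul_diagonal] <;> field_simp

theorem iota_mul_iota (y₁ y₂ z₁ z₂ : ℝ) (h₁ : 0 < y₁) (h₂ : 0 < y₂) (h₃ : 0 < z₁) (h₄ : 0 < z₂) :
    iota y₁ y₂ * iota z₁ z₂ = iota (y₁ * z₁) (y₂ * z₂) := by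
  apply Subtype.ext
  simp only [iota, h₁, h₂, h₃, h₄, mul_pos, and_self, dif_pos, Submonoid.coe_mul]
  rw [Matrix.fromBlocks_multiply]
  congr 1 <;> ext i j <;> fin_cases i <;> fin_cases j <;>
    simp [Real.sqrt_mul h₂.le] <;> ring

theorem iota_one_one : iota 1 1 = 1 := by
  apply Subtype.ext
  simp only [iota, zero_lt_one, and_self, dif_pos, Submonoid.coe_one]
  rw [← Matrix.fromBlocks_one]
  congr 1 <;> ext i j <;> fin_cases i <;> fin_cases j <;> simp

theorem continuous_unip : Continuous fun x : ℝ × ℝ × ℝ × ℝ => unip x.1 x.2.1 x.2.2.1 x.2.2.2 := by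
  refine Continuous.subtype_mk ?_ _
  refine continuous_matrix fun i j => ?_
  rcases i with i | i <;> rcases j with j | j <;> fin_cases i <;> fin_cases j <;> simp <;> fun_prop

/-- The upper triangular integral matrix in block form with the given entries. -/
def borelMatrix (t₁ t₂ k i b j l d₁ e d₂ : ℤ) : MatZ :=
  Matrix.fromBlocks !![t₁, k; 0, t₂] !![i, b; j, l] !![0, 0; 0, 0] !![d₁, 0; e, d₂]

/-- Dividing the diagonal by `√m` gives `√y₂ = t₂/√m` and `y₁ = t₁/t₂`. The entries `e` and `b` do
not occur on the right because the symplectic relations determine them. -/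
theorem normalize_borelMatrix (q m : ℕ) (t₁ t₂ k i b j l d₁ e d₂ : ℤ)
    (h : borelMatrix t₁ t₂ k i b j l d₁ e d₂ ∈ simil q m) (ht₁ : 0 < t₁) (ht₂ : 0 < t₂)
    (h₁ : t₁ * d₁ = m) (h₂ : t₂ * d₂ = m) (h₃ : k * d₁ + t₂ * e = 0)
    (h₄ : j * d₂ = b * d₁ + l * e) :
    normalize (⟨_, h⟩ : simil q m) =
      unip (k / t₂) (i / d₁) (j / d₁) (l / d₂) * iota (t₁ / t₂) (t₂ ^ 2 / m) := by
  have hm : (0 : ℝ) < m := by exact_mod_cast h.1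
  have ht₁' : (0 : ℝ) < t₁ := by exact_mod_cast ht₁
  have ht₂' : (0 : ℝ) < t₂ := by exact_mod_cast ht₂
  have h₁' : (t₁ : ℝ) * d₁ = m := by exact_mod_cast h₁
  have h₂' : (t₂ : ℝ) * d₂ = m := by exact_mod_cast h₂
  have h₃' : (k : ℝ) * d₁ + t₂ * e = 0 := by exact_mod_cast h₃
  have h₄' : (j : ℝ) * d₂ = b * d₁ + l * e := by exact_mod_cast h₄
  have hy₁ : (0 : ℝ) < t₁ / t₂ := by positivity
  have hy₂ : (0 : ℝ) < t₂ ^ 2 / m := by positivity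
  have hsq : √((t₂ : ℝ) ^ 2 / m) = t₂ / √m := by
    rw [Real.sqrt_div (by positivity), Real.sqrt_sq ht₂'.le]
  have hs0 : √(m : ℝ) ≠ 0 := (Real.sqrt_pos.2 hm).ne'
  have hs : (m : ℝ) = √m ^ 2 := (Real.sq_sqrt hm.le).symm
  have hd₁ : (d₁ : ℝ) = √m ^ 2 / t₁ := by rw [← hs]; field_simp; linarith
  have hd₂ : (d₂ : ℝ) = √m ^ 2 / t₂ := by rw [← hs]; field_simp; linarith
  have he : (e : ℝ) = - k * √m ^ 2 / (t₁ * t₂) := by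
    rw [hd₁] at h₃'; field_simp at h₃' ⊢; linarith
  have hb : (b : ℝ) = (j * t₁ + k * l) / t₂ := by
    rw [hd₁, hd₂, he] at h₄'; field_simp at h₄' ⊢; linarith
  apply Subtype.ext
  simp only [normalize, iota, hy₁, hy₂, and_self, dif_pos, unip, Submonoid.coe_mul, borelMatrix,
    hsq, hd₁, hd₂]
  rw [Matrix.fromBlocks_multiply, Matrix.fromBlocks_map, Matrix.fromBlocks_smul]
  generalize √(m : ℝ) = s at *
  congr 1 <;> ext i j <;> fin_cases i <;> fin_cases j <;>
    simp [Matrix.vecMul_diagonal, hb, hd₁, hd₂, he] <;> field_simp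

/-- Each coordinate is an affine function of its own variable plus a shift that involves only
variables integrated later, so every shift is constant during the integration that must absorb it.
-/
theorem unip_mul_iota_mul_unip (m t₁ t₂ k i j l d₁ d₂ : ℝ) (hm : 0 < m) (ht₁ : 0 < t₁)
    (ht₂ : 0 < t₂) (h₁ : t₁ * d₁ = m) (h₂ : t₂ * d₂ = m) (x₁₂ x₁₃ x₂₃ x₂₄ : ℝ) :
    unip (k / t₂) (i / d₁) (j / d₁) (l / d₂) * iota (t₁ / t₂) (t₂ ^ 2 / m) *
        unip x₁₂ x₁₃ x₂₃ x₂₄ =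
      unip ((k + t₁ * x₁₂) / t₂)
        ((i + t₁ * x₁₃) / d₁ + (k / t₂ * (t₂ * x₂₃ / d₁) - j / d₁ * (t₁ / t₂ * x₁₂) -
          k / t₂ * (l / d₂) * (t₁ / t₂ * x₁₂)))
        ((j + t₂ * x₂₃) / d₁ + -(l / d₂ * (t₁ / t₂ * x₁₂))) ((l + t₂ * x₂₄) / d₂) *
        iota (t₁ / t₂) (t₂ ^ 2 / m) := by
  have hd₁ : d₁ ≠ 0 := by rintro rfl; simp at h₁; linarith
  have hd₂ : d₂ ≠ 0 := by rintro rfl; simp at h₂; linarith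
  rw [mul_assoc, iota_mul_unip _ _ _ _ _ _ (by positivity) (by positivity), ← mul_assoc, unip_mul]
  have e1 : t₂ ^ 2 / m = t₂ / d₂ := by rw [← h₂]; field_simp
  have e2 : t₁ / t₂ * (t₂ ^ 2 / m) = t₂ / d₁ := by rw [← h₁]; field_simp
  have e3 : (t₁ / t₂) ^ 2 * (t₂ ^ 2 / m) = t₁ / d₁ := by rw [← h₁]; field_simp
  rw [e3, e2, e1]
  congr 2 <;> ring

/-! ### Reduction of similitudes to triangular form under Γ₀(q). -/

theorem exists_fromBlocks (N : MatZ) :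
    ∃ a₁₁ a₁₂ a₂₁ a₂₂ b₁₁ b₁₂ b₂₁ b₂₂ c₁₁ c₁₂ c₂₁ c₂₂ d₁₁ d₁₂ d₂₁ d₂₂ : ℤ,
      N = Matrix.fromBlocks !![a₁₁, a₁₂; a₂₁, a₂₂] !![b₁₁, b₁₂; b₂₁, b₂₂]
        !![c₁₁, c₁₂; c₂₁, c₂₂] !![d₁₁, d₁₂; d₂₁, d₂₂] :=
  ⟨_, _, _, _, _, _, _, _, _, _, _, _, _, _, _, _, (Matrix.fromBlocks_toBlocks N).symm.trans
    (congr (congr (congr (congrArg _ (Matrix.eta_fin_two _)) (Matrix.eta_fin_two _))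
      (Matrix.eta_fin_two _)) (Matrix.eta_fin_two _))⟩

theorem symplectic_similitude_iff
    {a₁₁ a₁₂ a₂₁ a₂₂ b₁₁ b₁₂ b₂₁ b₂₂ c₁₁ c₁₂ c₂₁ c₂₂ d₁₁ d₁₂ d₂₁ d₂₂ m : ℤ} :
    (Matrix.fromBlocks !![a₁₁, a₁₂; a₂₁, a₂₂] !![b₁₁, b₁₂; b₂₁, b₂₂]
        !![c₁₁, c₁₂; c₂₁, c₂₂] !![d₁₁, d₁₂; d₂₁, d₂₂])ᵀ * Matrix.J (Fin 2) ℤ *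
      Matrix.fromBlocks !![a₁₁, a₁₂; a₂₁, a₂₂] !![b₁₁, b₁₂; b₂₁, b₂₂]
        !![c₁₁, c₁₂; c₂₁, c₂₂] !![d₁₁, d₁₂; d₂₁, d₂₂] = m • Matrix.J (Fin 2) ℤ ↔
    a₁₁ * c₁₂ + a₂₁ * c₂₂ = c₁₁ * a₁₂ + c₂₁ * a₂₂ ∧
    b₁₁ * d₁₂ + b₂₁ * d₂₂ = d₁₁ * b₁₂ + d₂₁ * b₂₂ ∧
    a₁₁ * d₁₁ + a₂₁ * d₂₁ - c₁₁ * b₁₁ - c₂₁ * b₂₁ = m ∧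
    a₁₁ * d₁₂ + a₂₁ * d₂₂ - c₁₁ * b₁₂ - c₂₁ * b₂₂ = 0 ∧
    a₁₂ * d₁₁ + a₂₂ * d₂₁ - c₁₂ * b₁₁ - c₂₂ * b₂₁ = 0 ∧
    a₁₂ * d₁₂ + a₂₂ * d₂₂ - c₁₂ * b₁₂ - c₂₂ * b₂₂ = m := by
  rw [Matrix.J, Matrix.fromBlocks_transpose, Matrix.fromBlocks_multiply,
    Matrix.fromBlocks_multiply, Matrix.fromBlocks_smul, Matrix.fromBlocks_inj]
  simp only [← Matrix.ext_iff, Fin.forall_fin_two]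
  simp [Matrix.mul_apply, Fin.sum_univ_two]
  constructor
  · rintro ⟨⟨⟨h1, h2⟩, h3, h4⟩, ⟨⟨h5, h6⟩, h7, h8⟩, ⟨⟨h9, h10⟩, h11, h12⟩, ⟨h13, h14⟩, h15, h16⟩
    refine ⟨?_, ?_, ?_, ?_, ?_, ?_⟩ <;> linarith
  · rintro ⟨h1, h2, h3, h4, h5, h6⟩
    refine ⟨⟨⟨?_, ?_⟩, ?_, ?_⟩, ⟨⟨?_, ?_⟩, ?_, ?_⟩, ⟨⟨?_, ?_⟩, ?_, ?_⟩, ⟨?_, ?_⟩, ?_, ?_⟩ <;> linarith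

/-- A symplectic matrix with given blocks whose lower left block is divisible by `q`. -/
theorem exists_mem_Gamma0 (q : ℕ)
    {a₁₁ a₁₂ a₂₁ a₂₂ b₁₁ b₁₂ b₂₁ b₂₂ c₁₁ c₁₂ c₂₁ c₂₂ d₁₁ d₁₂ d₂₁ d₂₂ : ℤ}
    (h : a₁₁ * c₁₂ + a₂₁ * c₂₂ = c₁₁ * a₁₂ + c₂₁ * a₂₂ ∧
      b₁₁ * d₁₂ + b₂₁ * d₂₂ = d₁₁ * b₁₂ + d₂₁ * b₂₂ ∧
      a₁₁ * d₁₁ + a₂₁ * d₂₁ - c₁₁ * b₁₁ - c₂₁ * b₂₁ = 1 ∧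
      a₁₁ * d₁₂ + a₂₁ * d₂₂ - c₁₁ * b₁₂ - c₂₁ * b₂₂ = 0 ∧
      a₁₂ * d₁₁ + a₂₂ * d₂₁ - c₁₂ * b₁₁ - c₂₂ * b₂₁ = 0 ∧
      a₁₂ * d₁₂ + a₂₂ * d₂₂ - c₁₂ * b₁₂ - c₂₂ * b₂₂ = 1)
    (h₁₁ : (q : ℤ) ∣ c₁₁) (h₁₂ : (q : ℤ) ∣ c₁₂) (h₂₁ : (q : ℤ) ∣ c₂₁) (h₂₂ : (q : ℤ) ∣ c₂₂) :
    ∃ γ ∈ Gamma0 q, γ.1 = Matrix.fromBlocks !![a₁₁, a₁₂; a₂₁, a₂₂] !![b₁₁, b₁₂; b₂₁, b₂₂]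
        !![c₁₁, c₁₂; c₂₁, c₂₂] !![d₁₁, d₁₂; d₂₁, d₂₂] := by
  refine ⟨⟨_, SymplecticGroup.mem_iff'.2 ((symplectic_similitude_iff.2 h).trans (one_smul _ _))⟩,
    ?_, rfl⟩
  intro i j
  fin_cases i <;> fin_cases j <;> simpa

theorem mul_mem_simil {q m : ℕ} {γ : Sp4Z} (hγ : γ ∈ Gamma0 q) {N : MatZ} (hN : N ∈ simil q m) :
    γ.1 * N ∈ simil q m := by
  refine ⟨hN.1, ?_, fun i j => ?_⟩
  · have h := SymplecticGroup.mem_iff'.1 γ.2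
    rw [Matrix.transpose_mul, ← hN.2.1]
    conv_rhs => rw [← h]
    simp only [Matrix.mul_assoc]
  · rw [Matrix.mul_apply, Fintype.sum_sum_type]
    exact dvd_add (Finset.dvd_sum fun l _ => Dvd.dvd.mul_right (hγ i l) _)
      (Finset.dvd_sum fun l _ => Dvd.dvd.mul_left (hN.2.2 l j) _)

/-- Euclid's algorithm in the group `Γ₀(q) ⊆ SL(2, ℤ)`. -/
theorem exists_sl2_eq_gcd {q a c : ℤ} (hc : q ∣ c) (ha : IsCoprime a q) :
    ∃ α β γ δ : ℤ, α * δ - β * γ = 1 ∧ q ∣ γ ∧ γ * a + δ * c = 0 ∧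
      α * a + β * c = (Int.gcd a c : ℤ) := by
  rcases eq_or_ne (Int.gcd a c : ℤ) 0 with h | h
  · obtain ⟨rfl, rfl⟩ := Int.gcd_eq_zero_iff.1 (by exact_mod_cast h)
    exact ⟨1, 0, 0, 1, by simp, by simp, by simp, by simp⟩
  · obtain ⟨a', ha'⟩ := Int.gcd_dvd_left a c
    obtain ⟨c', hc'⟩ := Int.gcd_dvd_right a c
    have hb := Int.gcd_eq_gcd_ab a c
    generalize (Int.gcd a c : ℤ) = g at *
    generalize Int.gcdA a c = α at *
    generalize Int.gcdB a c = β at *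
    subst ha'
    subst hc'
    refine ⟨α, β, -c', a', ?_, ?_, by ring, by linarith⟩
    · exact mul_left_cancel₀ h (by linarith)
    -- The gcd divides `a`, hence is prime to `q`, so `q ∣ c` passes to the quotient `c'`.
    · exact (dvd_neg).2 ((IsCoprime.of_mul_left_left ha).symm.dvd_of_dvd_mul_left hc)

/-- Condition `hco` makes gcd(a₁, a₂) prime to `q`. Four moves: the Levi subgroup collects this gcd
in the first entry; an SL₂ in the first symplectic plane clears the entry below it; the Levi
subgroup collects a gcd `e` again; a lower unipotent matrix clears the rest. All divisors met on the
way stay prime to `q`, which keeps the moves in Γ₀(q). -/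
theorem exists_mulVec_eq {q : ℕ} {a₁ a₂ c₁ c₂ x y : ℤ} (h₁ : (q : ℤ) ∣ c₁) (h₂ : (q : ℤ) ∣ c₂)
    (hne : ¬ (a₁ = 0 ∧ a₂ = 0 ∧ c₁ = 0 ∧ c₂ = 0)) (hco : IsCoprime (a₁ * x + a₂ * y) (q : ℤ)) :
    ∃ γ ∈ Gamma0 q, ∃ e : ℤ, 0 < e ∧
      γ.1 *ᵥ Sum.elim ![a₁, a₂] ![c₁, c₂] = Sum.elim ![e, 0] ![0, 0] := by
  obtain ⟨α, β, γ, δ, hdet, -, hγ, hα⟩ := exists_sl2_eq_gcd (q := 1) (one_dvd a₂)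
    (isCoprime_one_right (x := a₁))
  have hgco : IsCoprime (Int.gcd a₁ a₂ : ℤ) (q : ℤ) :=
    hco.of_isCoprime_of_dvd_left (dvd_add ((Int.gcd_dvd_left _ _).mul_right _)
      ((Int.gcd_dvd_right _ _).mul_right _))
  generalize (Int.gcd a₁ a₂ : ℤ) = g at *
  obtain ⟨γ₁, hγ₁, e₁⟩ := exists_mem_Gamma0 q (a₁₁ := α) (a₁₂ := β) (a₂₁ := γ) (a₂₂ := δ)
    (b₁₁ := 0) (b₁₂ := 0) (b₂₁ := 0) (b₂₂ := 0) (c₁₁ := 0) (c₁₂ := 0) (c₂₁ := 0) (c₂₂ := 0)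
    (d₁₁ := δ) (d₁₂ := -γ) (d₂₁ := -β) (d₂₂ := α) (by refine ⟨?_, ?_, ?_, ?_, ?_, ?_⟩ <;> linarith)
    (by simp) (by simp) (by simp) (by simp)
  have hc₁' : (q : ℤ) ∣ δ * c₁ - γ * c₂ := dvd_sub (h₁.mul_left _) (h₂.mul_left _)
  have hc₂' : (q : ℤ) ∣ -β * c₁ + α * c₂ := dvd_add (h₁.mul_left _) (h₂.mul_left _)
  have v₁ : γ₁.1 *ᵥ Sum.elim ![a₁, a₂] ![c₁, c₂] =
      Sum.elim ![g, 0] ![δ * c₁ - γ * c₂, -β * c₁ + α * c₂] := by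
    rw [e₁, Matrix.fromBlocks_mulVec]
    congr 1 <;> ext i <;> fin_cases i <;> simp <;>
      linarith
  have hne₁ : ¬ (g = 0 ∧ δ * c₁ - γ * c₂ = 0 ∧ -β * c₁ + α * c₂ = 0) := by
    rintro ⟨h0, h3, h4⟩
    apply hne
    refine ⟨?_, ?_, ?_, ?_⟩
    · linear_combination δ * hα - β * hγ + δ * h0 - a₁ * hdet
    · linear_combination α * hγ - γ * hα - γ * h0 - a₂ * hdet
    · linear_combination α * h3 + γ * h4 - c₁ * hdet
    · linear_combination β * h3 + δ * h4 - c₂ * hdet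
  generalize δ * c₁ - γ * c₂ = s at *
  generalize -β * c₁ + α * c₂ = t at *
  clear hα hγ hdet e₁
  obtain ⟨α, β, γ, δ, hdet, hqγ, hγ, hα⟩ := exists_sl2_eq_gcd hc₁' hgco
  have hdco : IsCoprime (Int.gcd g s : ℤ) (q : ℤ) := hgco.of_isCoprime_of_dvd_left
    (Int.gcd_dvd_left _ _)
  have hne₂ : ¬ ((Int.gcd g s : ℤ) = 0 ∧ t = 0) := by
    rintro ⟨h3, h4⟩
    rw [Int.natCast_eq_zero, Int.gcd_eq_zero_iff] at h3
    exact hne₁ ⟨h3.1, h3.2, h4⟩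
  generalize (Int.gcd g s : ℤ) = d at *
  -- The entry `b₂₂ = 1` copies `t` into the upper half, where the next Levi move can absorb it into
  -- the gcd.
  obtain ⟨γ₂, hγ₂, e₂⟩ := exists_mem_Gamma0 q (a₁₁ := α) (a₁₂ := 0) (a₂₁ := 0) (a₂₂ := 1)
    (b₁₁ := β) (b₁₂ := 0) (b₂₁ := 0) (b₂₂ := 1) (c₁₁ := γ) (c₁₂ := 0) (c₂₁ := 0) (c₂₂ := 0)
    (d₁₁ := δ) (d₁₂ := 0) (d₂₁ := 0) (d₂₂ := 1) (by refine ⟨?_, ?_, ?_, ?_, ?_, ?_⟩ <;> linarith)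
    hqγ (by simp) (by simp) (by simp)
  have v₂ : γ₂.1 *ᵥ Sum.elim ![g, 0] ![s, t] = Sum.elim ![d, t] ![0, t] := by
    rw [e₂, Matrix.fromBlocks_mulVec]
    congr 1 <;> ext i <;> fin_cases i <;> simp <;>
      linarith
  clear hα hγ hdet e₂
  obtain ⟨α, β, γ, δ, hdet, -, hγ, hα⟩ := exists_sl2_eq_gcd (q := 1) (one_dvd t)
    (isCoprime_one_right (x := d))
  have heco : IsCoprime (Int.gcd d t : ℤ) (q : ℤ) := hdco.of_isCoprime_of_dvd_left
    (Int.gcd_dvd_left _ _)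
  have hpos : 0 < (Int.gcd d t : ℤ) := by
    refine lt_of_le_of_ne (by positivity) fun h0 => hne₂ ?_
    have := h0.symm
    rwa [Int.natCast_eq_zero, Int.gcd_eq_zero_iff] at this
  obtain ⟨t', ht'⟩ := Int.gcd_dvd_right d t
  generalize (Int.gcd d t : ℤ) = e at *
  obtain ⟨γ₃, hγ₃, e₃⟩ := exists_mem_Gamma0 q (a₁₁ := α) (a₁₂ := β) (a₂₁ := γ) (a₂₂ := δ)
    (b₁₁ := 0) (b₁₂ := 0) (b₂₁ := 0) (b₂₂ := 0) (c₁₁ := 0) (c₁₂ := 0) (c₂₁ := 0) (c₂₂ := 0)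
    (d₁₁ := δ) (d₁₂ := -γ) (d₂₁ := -β) (d₂₂ := α) (by refine ⟨?_, ?_, ?_, ?_, ?_, ?_⟩ <;> linarith)
    (by simp) (by simp) (by simp) (by simp)
  have v₃ : γ₃.1 *ᵥ Sum.elim ![d, t] ![0, t] = Sum.elim ![e, 0] ![-γ * t, α * t] := by
    rw [e₃, Matrix.fromBlocks_mulVec]
    congr 1 <;> ext i <;> fin_cases i <;> simp <;>
      linarith
  have hqt : (q : ℤ) ∣ t' := heco.symm.dvd_of_dvd_mul_left (ht' ▸ hc₂')
  -- Only the first column of the lower left block acts on `(e, 0)`; symmetry of the block dictates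
  -- `c₁₂`.
  obtain ⟨γ₄, hγ₄, e₄⟩ := exists_mem_Gamma0 q (a₁₁ := 1) (a₁₂ := 0) (a₂₁ := 0) (a₂₂ := 1)
    (b₁₁ := 0) (b₁₂ := 0) (b₂₁ := 0) (b₂₂ := 0) (c₁₁ := γ * t') (c₁₂ := -α * t')
    (c₂₁ := -α * t') (c₂₂ := 0)
    (d₁₁ := 1) (d₁₂ := 0) (d₂₁ := 0) (d₂₂ := 1) (by refine ⟨?_, ?_, ?_, ?_, ?_, ?_⟩ <;> linarith)
    (hqt.mul_left _) (hqt.mul_left _) (hqt.mul_left _) (by simp)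
  have v₄ : γ₄.1 *ᵥ Sum.elim ![e, 0] ![-γ * t, α * t] = Sum.elim ![e, 0] ![0, 0] := by
    rw [e₄, Matrix.fromBlocks_mulVec, ht']
    congr 1 <;> ext i <;> fin_cases i <;> simp <;>
      ring
  refine ⟨γ₄ * γ₃ * γ₂ * γ₁, mul_mem (mul_mem (mul_mem hγ₄ hγ₃) hγ₂) hγ₁, e, hpos, ?_⟩
  simp only [Submonoid.coe_mul, ← Matrix.mulVec_mulVec]
  rw [v₁, v₂, v₃, v₄]

theorem borelMatrix_mem_simil_iff {q m : ℕ} {t₁ t₂ k i b j l d₁ e d₂ : ℤ} :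
    borelMatrix t₁ t₂ k i b j l d₁ e d₂ ∈ simil q m ↔
      0 < m ∧ t₁ * d₁ = m ∧ t₂ * d₂ = m ∧ k * d₁ + t₂ * e = 0 ∧ j * d₂ = b * d₁ + l * e := by
  refine and_congr_right fun _ => ?_
  have hq : LowerLeftDvd q (borelMatrix t₁ t₂ k i b j l d₁ e d₂) := fun i j => by
    fin_cases i <;> fin_cases j <;> simp [borelMatrix]
  rw [and_iff_left hq, borelMatrix, symplectic_similitude_iff]
  constructor
  · rintro ⟨h1, h2, h3, h4, h5, h6⟩
    refine ⟨?_, ?_, ?_, ?_⟩ <;> linarith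
  · rintro ⟨h1, h2, h3, h4⟩
    refine ⟨?_, ?_, ?_, ?_, ?_, ?_⟩ <;> linarith

/-- Modulo `q` the multiplier relation for the first column reads `m ≡ a₁₁d₁₁ + a₂₁d₂₁`, so that
column satisfies the coprimality condition of `exists_mulVec_eq`. Once it is `(t₁, 0, 0, 0)`, the
symplectic relations force `c₁₂ = d₁₂ = 0`, and Euclid's algorithm in the second symplectic plane
finishes. -/
theorem exists_mul_eq_borelMatrix {q m : ℕ} (hmq : m.Coprime q) {N : MatZ} (hN : N ∈ simil q m) :
    ∃ γ ∈ Gamma0 q, ∃ t₁ t₂ k i b j l d₁ e d₂ : ℤ, 0 < t₁ ∧ 0 < t₂ ∧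
      γ.1 * N = borelMatrix t₁ t₂ k i b j l d₁ e d₂ := by
  have hm : (m : ℤ) ≠ 0 := by exact_mod_cast hN.1.ne'
  have hmq' : IsCoprime (m : ℤ) (q : ℤ) := Nat.isCoprime_iff_coprime.2 hmq
  obtain ⟨γ₁, hγ₁, t₁, ht₁, h₁⟩ : ∃ γ ∈ Gamma0 q, ∃ t₁ : ℤ, 0 < t₁ ∧
      γ.1 *ᵥ (fun i => N i (Sum.inl 0)) = Sum.elim ![t₁, 0] ![0, 0] := by
    obtain ⟨a₁₁, a₁₂, a₂₁, a₂₂, b₁₁, b₁₂, b₂₁, b₂₂, c₁₁, c₁₂, c₂₁, c₂₂, d₁₁, d₁₂, d₂₁, d₂₂, rfl⟩ :=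
      exists_fromBlocks N
    obtain ⟨-, -, h, -⟩ := symplectic_similitude_iff.1 hN.2.1
    have hc₁ : (q : ℤ) ∣ c₁₁ := by simpa using hN.2.2 0 0
    have hc₂ : (q : ℤ) ∣ c₂₁ := by simpa using hN.2.2 1 0
    have hv : (fun i => (Matrix.fromBlocks !![a₁₁, a₁₂; a₂₁, a₂₂] !![b₁₁, b₁₂; b₂₁, b₂₂]
        !![c₁₁, c₁₂; c₂₁, c₂₂] !![d₁₁, d₁₂; d₂₁, d₂₂] : MatZ) i (Sum.inl 0)) =
        Sum.elim ![a₁₁, a₂₁] ![c₁₁, c₂₁] := by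
      ext i
      rcases i with i | i <;> fin_cases i <;> simp
    rw [hv]
    refine exists_mulVec_eq (x := d₁₁) (y := d₂₁) hc₁ hc₂ ?_ ?_
    · rintro ⟨rfl, rfl, rfl, rfl⟩
      exact hm (by linarith)
    · obtain ⟨c, rfl⟩ := hc₁
      obtain ⟨c', rfl⟩ := hc₂
      rw [show a₁₁ * d₁₁ + a₂₁ * d₂₁ = m + q * (c * b₁₁ + c' * b₂₁) by linarith]
      exact (IsCoprime.add_mul_left_left_iff).2 hmq'
  have hN₁ := mul_mem_simil hγ₁ hN
  have hcol : (fun i => (γ₁.1 * N) i (Sum.inl 0)) = Sum.elim ![t₁, 0] ![0, 0] := h₁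
  suffices h : ∃ γ ∈ Gamma0 q, ∃ t₁ t₂ k i b j l d₁ e d₂ : ℤ, 0 < t₁ ∧ 0 < t₂ ∧
      γ.1 * (γ₁.1 * N) = borelMatrix t₁ t₂ k i b j l d₁ e d₂ by
    obtain ⟨γ, hγ, t₁, t₂, k, i, b, j, l, d₁, e, d₂, h⟩ := h
    exact ⟨γ * γ₁, mul_mem hγ hγ₁, t₁, t₂, k, i, b, j, l, d₁, e, d₂, by
      rwa [Submonoid.coe_mul, Matrix.mul_assoc]⟩
  clear h₁
  generalize γ₁.1 * N = N₁ at *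
  clear hN
  obtain ⟨a₁₁, a₁₂, a₂₁, a₂₂, b₁₁, b₁₂, b₂₁, b₂₂, c₁₁, c₁₂, c₂₁, c₂₂, d₁₁, d₁₂, d₂₁, d₂₂, rfl⟩ :=
    exists_fromBlocks N₁
  obtain rfl : a₁₁ = t₁ := by simpa using congrFun hcol (Sum.inl 0)
  obtain rfl : a₂₁ = 0 := by simpa using congrFun hcol (Sum.inl 1)
  obtain rfl : c₁₁ = 0 := by simpa using congrFun hcol (Sum.inr 0)
  obtain rfl : c₂₁ = 0 := by simpa using congrFun hcol (Sum.inr 1)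
  obtain ⟨h1, -, -, h4, -, h6⟩ := symplectic_similitude_iff.1 hN₁.2.1
  obtain rfl : c₁₂ = 0 := by simpa [ht₁.ne'] using h1
  obtain rfl : d₁₂ = 0 := by simpa [ht₁.ne'] using h4
  have hc : (q : ℤ) ∣ c₂₂ := by simpa using hN₁.2.2 1 1
  have ha : IsCoprime a₂₂ (q : ℤ) := by
    obtain ⟨c, rfl⟩ := hc
    have : IsCoprime (a₂₂ * d₂₂) (q : ℤ) := by
      rw [show a₂₂ * d₂₂ = m + q * (c * b₂₂) by linarith]
      exact (IsCoprime.add_mul_left_left_iff).2 hmq'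
    exact this.of_mul_left_left
  obtain ⟨α, β, γ, δ, hdet, hqγ, hγ, hα⟩ := exists_sl2_eq_gcd hc ha
  have hg : 0 < (Int.gcd a₂₂ c₂₂ : ℤ) := by
    refine lt_of_le_of_ne (by positivity) fun h0 => ?_
    have := h0.symm
    rw [Int.natCast_eq_zero, Int.gcd_eq_zero_iff] at this
    rw [this.1, this.2] at h6
    exact hm (by linarith)
  obtain ⟨γ₂, hγ₂, e₂⟩ := exists_mem_Gamma0 q (a₁₁ := 1) (a₁₂ := 0) (a₂₁ := 0) (a₂₂ := α)
    (b₁₁ := 0) (b₁₂ := 0) (b₂₁ := 0) (b₂₂ := β) (c₁₁ := 0) (c₁₂ := 0) (c₂₁ := 0) (c₂₂ := γ)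
    (d₁₁ := 1) (d₁₂ := 0) (d₂₁ := 0) (d₂₂ := δ) (by refine ⟨?_, ?_, ?_, ?_, ?_, ?_⟩ <;> linarith)
    (by simp) (by simp) (by simp) hqγ
  have hN₂ := mul_mem_simil hγ₂ hN₁
  refine ⟨γ₂, hγ₂, a₁₁, Int.gcd a₂₂ c₂₂, a₁₂, b₁₁, b₁₂, α * b₂₁ + β * d₂₁, α * b₂₂ + β * d₂₂,
    d₁₁, γ * b₂₁ + δ * d₂₁, γ * b₂₂ + δ * d₂₂, ht₁, hg, ?_⟩
  rw [e₂, Matrix.fromBlocks_multiply, borelMatrix]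
  congr 1 <;> ext i j <;> fin_cases i <;> fin_cases j <;> simp <;> linarith

/-- Left multiplication by integral unipotent matrices shifts `k`, `l`, `j`, `i` by multiples of
`t₂`, `d₂`, `d₁`, `d₁`. In this order, each new parameter leaves the entries already reduced
untouched. -/
theorem exists_reduced {q m : ℕ} {t₁ t₂ k i b j l d₁ e d₂ : ℤ} (ht₁ : 0 < t₁) (ht₂ : 0 < t₂)
    (h : borelMatrix t₁ t₂ k i b j l d₁ e d₂ ∈ simil q m) :
    ∃ γ ∈ Gamma0 q, ∃ k' i' b' j' l' e' : ℤ, (0 ≤ k' ∧ k' < t₂) ∧ (0 ≤ i' ∧ i' < d₁) ∧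
      (0 ≤ j' ∧ j' < d₁) ∧ (0 ≤ l' ∧ l' < d₂) ∧
      γ.1 * borelMatrix t₁ t₂ k i b j l d₁ e d₂ = borelMatrix t₁ t₂ k' i' b' j' l' d₁ e' d₂ := by
  obtain ⟨hm, h1, h2, -⟩ := borelMatrix_mem_simil_iff.1 h
  have hd₁ : 0 < d₁ := pos_of_mul_pos_right (h1 ▸ by exact_mod_cast hm) ht₁.le
  have hd₂ : 0 < d₂ := pos_of_mul_pos_right (h2 ▸ by exact_mod_cast hm) ht₂.le
  have key : ∀ x c d : ℤ, 0 < d → ∃ n, 0 ≤ x + n * d + c ∧ x + n * d + c < d := fun x c d hd =>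
    ⟨-((x + c) / d), by
      rw [show x + -((x + c) / d) * d + c = (x + c) % d by rw [Int.emod_def]; ring]
      exact ⟨Int.emod_nonneg _ hd.ne', Int.emod_lt_of_pos _ hd⟩⟩
  obtain ⟨x, hx⟩ := key k 0 t₂ ht₂
  obtain ⟨y, hy⟩ := key l 0 d₂ hd₂
  obtain ⟨z, hz⟩ := key j (y * e) d₁ hd₁
  obtain ⟨w, hw⟩ := key i (x * j + (z + x * y) * e) d₁ hd₁
  -- The entry `b₁₂ = z + x * y` is forced by the symplectic condition.
  obtain ⟨γ, hγ, e₁⟩ := exists_mem_Gamma0 q (a₁₁ := 1) (a₁₂ := x) (a₂₁ := 0) (a₂₂ := 1)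
    (b₁₁ := w) (b₁₂ := z + x * y) (b₂₁ := z) (b₂₂ := y) (c₁₁ := 0) (c₁₂ := 0) (c₂₁ := 0)
    (c₂₂ := 0) (d₁₁ := 1) (d₁₂ := 0) (d₂₁ := -x) (d₂₂ := 1)
    (by refine ⟨?_, ?_, ?_, ?_, ?_, ?_⟩ <;> linarith)
    (by simp) (by simp) (by simp) (by simp)
  refine ⟨γ, hγ, k + x * t₂ + 0, i + w * d₁ + (x * j + (z + x * y) * e),
    b + x * l + (z + x * y) * d₂, j + z * d₁ + y * e, l + y * d₂ + 0, -x * d₁ + e,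
    hx, hw, hz, hy, ?_⟩
  rw [e₁, borelMatrix, Matrix.fromBlocks_multiply, borelMatrix]
  congr 1 <;> ext i j <;> fin_cases i <;> fin_cases j <;> simp <;> ring

/-- Both matrices being triangular with positive diagonal, `γ` is integral unipotent. Its remaining
entries vanish one at a time, since two members of the same interval of residues cannot differ by a
nonzero multiple of the modulus. -/
theorem eq_of_mul_borelMatrix_eq {γ : Sp4Z} {t₁ t₂ k i b j l d₁ e d₂ : ℤ}
    {t₁' t₂' k' i' b' j' l' d₁' e' d₂' : ℤ} (ht₁ : 0 < t₁) (ht₂ : 0 < t₂) (ht₁' : 0 < t₁')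
    (hk : 0 ≤ k ∧ k < t₂) (hi : 0 ≤ i ∧ i < d₁) (hj : 0 ≤ j ∧ j < d₁) (hl : 0 ≤ l ∧ l < d₂)
    (hk' : 0 ≤ k' ∧ k' < t₂') (hi' : 0 ≤ i' ∧ i' < d₁') (hj' : 0 ≤ j' ∧ j' < d₁')
    (hl' : 0 ≤ l' ∧ l' < d₂')
    (h : γ.1 * borelMatrix t₁ t₂ k i b j l d₁ e d₂ =
      borelMatrix t₁' t₂' k' i' b' j' l' d₁' e' d₂') :
    t₁ = t₁' ∧ t₂ = t₂' ∧ k = k' ∧ l = l' ∧ j = j' ∧ i = i' := by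
  have small : ∀ x y n d : ℤ, (0 ≤ x ∧ x < d) → (0 ≤ y ∧ y < d) → x + n * d = y → n = 0 := by
    intro x y n d hx hy hxy
    by_contra hn
    rcases lt_or_gt_of_ne hn with hn | hn <;> nlinarith
  obtain ⟨a₁₁, a₁₂, a₂₁, a₂₂, b₁₁, b₁₂, b₂₁, b₂₂, c₁₁, c₁₂, c₂₁, c₂₂, d₁₁, d₁₂, d₂₁, d₂₂, hγ⟩ :=
    exists_fromBlocks γ.1
  have hs := (SymplecticGroup.mem_iff'.1 γ.2).trans (one_smul ℤ _).symm
  rw [hγ] at hs h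
  obtain ⟨-, s2, s3, s4, s5, s6⟩ := symplectic_similitude_iff.1 hs
  rw [borelMatrix, borelMatrix, Matrix.fromBlocks_multiply, Matrix.fromBlocks_inj] at h
  simp only [← Matrix.ext_iff, Fin.forall_fin_two] at h
  simp only [mul_fin_two, Matrix.add_apply, of_apply, cons_val', cons_val_zero, cons_val_fin_one,
    cons_val_one, mul_zero, add_zero, zero_add] at h
  obtain ⟨⟨⟨h1, h2⟩, h3, h4⟩, ⟨⟨h5, -⟩, h7, h8⟩, ⟨⟨h9, h10⟩, h11, h12⟩, ⟨h13, -⟩, -, h16⟩ := h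
  obtain rfl : c₁₁ = 0 := by simpa [ht₁.ne'] using h9
  obtain rfl : c₂₁ = 0 := by simpa [ht₁.ne'] using h11
  obtain rfl : a₂₁ = 0 := by simpa [ht₁.ne'] using h3
  obtain rfl : c₁₂ = 0 := by simpa [ht₂.ne'] using h10
  obtain rfl : c₂₂ = 0 := by simpa [ht₂.ne'] using h12
  have pos : ∀ x y z : ℤ, 0 < x → 0 < z → y * x = z → 0 < y := fun x y z hx hz h =>
    pos_of_mul_pos_left (h ▸ hz) hx.le
  have one : ∀ x y : ℤ, 0 < x → x * y = 1 → x = 1 ∧ y = 1 := by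
    intro x y hx h
    have hx1 := Int.eq_one_or_neg_one_of_mul_eq_one h
    obtain rfl : x = 1 := by omega
    exact ⟨rfl, by linarith⟩
  obtain ⟨rfl, rfl⟩ := one a₁₁ d₁₁ (pos _ _ _ ht₁ ht₁' h1) (by linarith)
  obtain rfl : d₁₂ = 0 := by linarith
  obtain ⟨rfl, rfl⟩ := one a₂₂ d₂₂ (pos _ _ _ ht₂ (by linarith) (by linarith : a₂₂ * t₂ = t₂'))
    (by linarith)
  have ht : t₂ = t₂' := by linarith
  subst ht
  have hd : d₁ = d₁' := by linarith
  subst hd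
  have hd : d₂ = d₂' := by linarith
  subst hd
  obtain rfl : a₁₂ = 0 := small k k' _ t₂ hk hk' (by linarith)
  obtain rfl : d₂₁ = 0 := by linarith
  obtain rfl : b₂₁ = b₁₂ := by linarith
  obtain rfl : b₂₂ = 0 := small l l' _ d₂ hl hl' (by linarith)
  obtain rfl : b₂₁ = 0 := small j j' _ d₁ hj hj' (by linarith)
  obtain rfl : b₁₁ = 0 := small i i' _ d₁ hi hi' (by linarith)
  refine ⟨?_, ?_, ?_, ?_, ?_, ?_⟩ <;> linarith

/-! ### Explicit representatives of the Hecke cosets. -/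

/-- Indices `((t₁, t₂), k, l, j, i)` of the representatives of `Γ₀(q) \ simil q m`. -/
def repSet (m : ℕ) : Finset (Σ _ : ℕ × ℕ, ℕ × ℕ × ℕ × ℕ) :=
  ((m.divisors ×ˢ m.divisors).sigma fun t =>
    Finset.range t.2 ×ˢ Finset.range (m / t.2) ×ˢ Finset.range (m / t.1) ×ˢ
      Finset.range (m / t.1)).filter fun x =>
    x.1.1 * x.1.2 ∣ m * x.2.1 ∧ x.1.2 ∣ x.2.2.2.1 * x.1.1 + x.2.1 * x.2.2.1

/-- The upper triangular representative with index `((t₁, t₂), k, l, j, i)`. -/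
def repMatrix (m : ℕ) : (Σ _ : ℕ × ℕ, ℕ × ℕ × ℕ × ℕ) → MatZ
  | ⟨(t₁, t₂), k, l, j, i⟩ => borelMatrix t₁ t₂ k i ((j * t₁ + k * l) / t₂ : ℕ) j l (m / t₁ : ℕ)
      (-(m * k / (t₁ * t₂) : ℕ)) (m / t₂ : ℕ)

/-- The representative `repMatrix`, scaled to an element of `Sp(4, ℝ)`. -/
def repSp (m : ℕ) : (Σ _ : ℕ × ℕ, ℕ × ℕ × ℕ × ℕ) → Sp4
  | ⟨(t₁, t₂), k, l, j, i⟩ => unip (k / t₂) (i / (m / t₁ : ℕ)) (j / (m / t₁ : ℕ))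
      (l / (m / t₂ : ℕ)) * iota (t₁ / t₂) (t₂ ^ 2 / m)

theorem mem_repSet {m t₁ t₂ k l j i : ℕ} : (⟨(t₁, t₂), k, l, j, i⟩ : Σ _ : ℕ × ℕ, _) ∈ repSet m ↔
    (((t₁ ∣ m ∧ m ≠ 0) ∧ t₂ ∣ m ∧ m ≠ 0) ∧ k < t₂ ∧ l < m / t₂ ∧ j < m / t₁ ∧ i < m / t₁) ∧
      t₁ * t₂ ∣ m * k ∧ t₂ ∣ j * t₁ + k * l := by
  simp [repSet]

/-- The two divisibility conditions in `repSet` say exactly that the entries `e` and `b` dictated by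
the symplectic relations are integers, so the truncating quotients in `repMatrix` are exact. -/
theorem rep_relations {m t₁ t₂ k l j i : ℕ}
    (h : (⟨(t₁, t₂), k, l, j, i⟩ : Σ _ : ℕ × ℕ, _) ∈ repSet m) :
    0 < t₁ ∧ 0 < t₂ ∧ 0 < m ∧ (t₁ : ℤ) * (m / t₁ : ℕ) = m ∧ (t₂ : ℤ) * (m / t₂ : ℕ) = m ∧
      (k : ℤ) * (m / t₁ : ℕ) + t₂ * -(m * k / (t₁ * t₂) : ℕ) = 0 ∧
      (j : ℤ) * (m / t₂ : ℕ) = ((j * t₁ + k * l) / t₂ : ℕ) * (m / t₁ : ℕ) +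
        l * -(m * k / (t₁ * t₂) : ℕ) := by
  obtain ⟨⟨⟨⟨⟨c₁, rfl⟩, hm⟩, ⟨c₂, h₂⟩, -⟩, -⟩, ⟨c₃, h₃⟩, ⟨c₄, h₄⟩⟩ := mem_repSet.1 h
  have ht₁ : 0 < t₁ := Nat.pos_of_ne_zero (by rintro rfl; simp at hm)
  have ht₂ : 0 < t₂ := Nat.pos_of_ne_zero (by rintro rfl; rw [h₂] at hm; simp at hm)
  rw [h₃, h₄, Nat.mul_div_cancel_left _ ht₁, Nat.mul_div_cancel_left _ ht₂,
    Nat.mul_div_cancel_left _ (Nat.mul_pos ht₁ ht₂), h₂, Nat.mul_div_cancel_left _ ht₂]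
  have e₃ : k * c₁ = t₂ * c₃ := Nat.eq_of_mul_eq_mul_left ht₁ (by linarith)
  have hm' := Nat.pos_of_ne_zero (h₂ ▸ hm)
  zify at h₂ e₃ h₄
  refine ⟨ht₁, ht₂, hm', ?_, ?_, ?_, ?_⟩
  · push_cast; linarith
  · push_cast; linarith
  · linarith
  · have : (t₂ : ℤ) ≠ 0 := by exact_mod_cast ht₂.ne'
    refine mul_left_cancel₀ this ?_
    linear_combination c₁ * h₄ - (l : ℤ) * e₃ - (j : ℤ) * h₂

theorem repMatrix_mem_simil (q : ℕ) {m : ℕ} {x : Σ _ : ℕ × ℕ, ℕ × ℕ × ℕ × ℕ} (hx : x ∈ repSet m) :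
    repMatrix m x ∈ simil q m := by
  obtain ⟨⟨t₁, t₂⟩, k, l, j, i⟩ := x
  obtain ⟨-, -, hm, h⟩ := rep_relations hx
  exact borelMatrix_mem_simil_iff.2 ⟨hm, h⟩

theorem normalize_repMatrix (q : ℕ) {m : ℕ} {x : Σ _ : ℕ × ℕ, ℕ × ℕ × ℕ × ℕ}
    (hx : x ∈ repSet m) :
    normalize (⟨repMatrix m x, repMatrix_mem_simil q hx⟩ : simil q m) = repSp m x := by
  obtain ⟨⟨t₁, t₂⟩, k, l, j, i⟩ := x
  obtain ⟨ht₁, ht₂, hm, h₁, h₂, h₃, h₄⟩ := rep_relations hx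
  have h := normalize_borelMatrix q m t₁ t₂ k i _ j l _ _ _
    (borelMatrix_mem_simil_iff.2 ⟨hm, h₁, h₂, h₃, h₄⟩)
    (by exact_mod_cast ht₁) (by exact_mod_cast ht₂) h₁ h₂ h₃ h₄
  simp only [Int.cast_natCast] at h
  exact h

theorem normalize_eq_of_mul {q m : ℕ} {N N' : simil q m} {γ : Sp4Z} (h : N'.1 = γ.1 * N.1) :
    normalize N' = toReal γ * normalize N := by
  apply Subtype.ext
  simp only [normalize, toReal, Submonoid.coe_mul, h, Matrix.map_mul, Matrix.mul_smul]

theorem repMatrix_injOn {m : ℕ} {x y : Σ _ : ℕ × ℕ, ℕ × ℕ × ℕ × ℕ} (hx : x ∈ repSet m)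
    (hy : y ∈ repSet m) {γ : Sp4Z} (h : repMatrix m y = γ.1 * repMatrix m x) : x = y := by
  obtain ⟨⟨t₁, t₂⟩, k, l, j, i⟩ := x
  obtain ⟨⟨t₁', t₂'⟩, k', l', j', i'⟩ := y
  obtain ⟨ht₁, ht₂, -⟩ := rep_relations hx
  obtain ⟨ht₁', -⟩ := rep_relations hy
  obtain ⟨⟨-, hk, hl, hj, hi⟩, -⟩ := mem_repSet.1 hx
  obtain ⟨⟨-, hk', hl', hj', hi'⟩, -⟩ := mem_repSet.1 hy
  have := eq_of_mul_borelMatrix_eq (by exact_mod_cast ht₁) (by exact_mod_cast ht₂)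
    (by exact_mod_cast ht₁') (by constructor <;> omega) (by constructor <;> omega)
    (by constructor <;> omega) (by constructor <;> omega) (by constructor <;> omega)
    (by constructor <;> omega) (by constructor <;> omega) (by constructor <;> omega) h.symm
  norm_cast at this
  obtain ⟨rfl, rfl, rfl, rfl, rfl, rfl⟩ := this
  rfl

theorem exists_repMatrix {q m : ℕ} (hmq : m.Coprime q) {N : MatZ} (hN : N ∈ simil q m) :
    ∃ x ∈ repSet m, ∃ γ ∈ Gamma0 q, repMatrix m x = γ.1 * N := by
  obtain ⟨γ, hγ, t₁, t₂, k, i, b, j, l, d₁, e, d₂, ht₁, ht₂, h⟩ :=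
    exists_mul_eq_borelMatrix hmq hN
  have hN₁ := mul_mem_simil hγ hN
  rw [h] at hN₁
  obtain ⟨γ', hγ', k, i, b', j, l, e', hk, hi, hj, hl, h'⟩ := exists_reduced ht₁ ht₂ hN₁
  have hN₂ := mul_mem_simil hγ' hN₁
  rw [h'] at hN₂
  rw [← h, ← Matrix.mul_assoc] at h'
  obtain ⟨hm, h1, h2, h3, h4⟩ := borelMatrix_mem_simil_iff.1 hN₂
  lift t₁ to ℕ using ht₁.le
  lift t₂ to ℕ using ht₂.le
  lift k to ℕ using hk.1
  lift i to ℕ using hi.1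
  lift j to ℕ using hj.1
  lift l to ℕ using hl.1
  lift d₁ to ℕ using hi.1.trans hi.2.le
  lift d₂ to ℕ using hl.1.trans hl.2.le
  norm_cast at h1 h2 ht₁ ht₂
  have hd₁ : m / t₁ = d₁ := by rw [← h1, Nat.mul_div_cancel_left _ ht₁]
  have hd₂ : m / t₂ = d₂ := by rw [← h2, Nat.mul_div_cancel_left _ ht₂]
  have hz₁ : (t₁ : ℤ) * d₁ = m := by exact_mod_cast h1
  have hz₂ : (t₂ : ℤ) * d₂ = m := by exact_mod_cast h2
  have he : (m * k : ℤ) = t₁ * t₂ * -e' := by linear_combination t₁ * h3 - k * hz₁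
  have hm0 : (m : ℤ) ≠ 0 := by exact_mod_cast hm.ne'
  have hb : (j * t₁ + k * l : ℤ) = t₂ * b' := by
    refine mul_left_cancel₀ hm0 ?_
    linear_combination (t₁ * t₂ : ℤ) * h4 - (t₁ * j : ℤ) * hz₂ + (b' * t₂ : ℤ) * hz₁ + l * he
  have hmem : (⟨(t₁, t₂), k, l, j, i⟩ : Σ _ : ℕ × ℕ, _) ∈ repSet m := by
    rw [mem_repSet, hd₁, hd₂]
    refine ⟨⟨⟨⟨⟨_, h1.symm⟩, hm.ne'⟩, ⟨_, h2.symm⟩, hm.ne'⟩, ?_⟩, ?_, ?_⟩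
    · refine ⟨?_, ?_, ?_, ?_⟩ <;> omega
    · exact Int.natCast_dvd_natCast.1 ⟨_, by push_cast; exact he⟩
    · exact Int.natCast_dvd_natCast.1 ⟨_, by push_cast; exact hb⟩
  refine ⟨_, hmem, γ' * γ, mul_mem hγ' hγ, ?_⟩
  rw [Submonoid.coe_mul, h', repMatrix, hd₁, hd₂]
  have ht₁' : (t₁ : ℤ) ≠ 0 := by exact_mod_cast ht₁.ne'
  have ht₂' : (t₂ : ℤ) ≠ 0 := by exact_mod_cast ht₂.ne'
  congr 1
  · push_cast
    rw [hb, Int.mul_ediv_cancel_left _ ht₂']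
  · push_cast
    rw [he, Int.mul_ediv_cancel_left _ (mul_ne_zero ht₁' ht₂'), neg_neg]

theorem heckeOperator_eq_sum {q m : ℕ} (hmq : m.Coprime q) {ϖ : Sp4 → ℂ}
    (hϖ : ∀ γ ∈ Gamma0 q, ∀ g, ϖ (toReal γ * g) = ϖ g) (g : Sp4) :
    heckeOperator q m ϖ g = ∑ x ∈ repSet m, ϖ (repSp m x * g) := by
  let f : repSet m → Quotient (cosetSetoid q m) := fun x => Quotient.mk _
    ⟨repMatrix m x, repMatrix_mem_simil q x.2⟩
  have hf : Function.Bijective f := by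
    constructor
    · intro x y hxy
      obtain ⟨γ, -, h⟩ := Quotient.exact hxy
      exact Subtype.ext (repMatrix_injOn x.2 y.2 h)
    · intro c
      induction c using Quotient.inductionOn with
      | h N =>
        obtain ⟨x, hx, γ, hγ, h⟩ := exists_repMatrix hmq N.2
        exact ⟨⟨x, hx⟩, (Quotient.sound ⟨γ, hγ, h⟩ : Quotient.mk (cosetSetoid q m) N = _).symm⟩
  rw [heckeOperator, ← Finset.sum_coe_sort (repSet m) fun x => ϖ (repSp m x * g),
    ← finsum_eq_sum_of_fintype]
  refine (finsum_eq_of_bijective f hf fun x => ?_).symm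
  -- The chosen coset representative differs from the triangular one by an element of Γ₀(q), which
  -- `ϖ` absorbs.
  obtain ⟨γ, hγ, h⟩ := Quotient.mk_out (s := cosetSetoid q m)
    ⟨repMatrix m x, repMatrix_mem_simil q x.2⟩
  rw [← normalize_repMatrix q x.2, normalize_eq_of_mul h, mul_assoc, hϖ γ hγ]

/-! ### Periodic functions, weighted sums of translates and the additive character. -/

/-- The additive character `t ↦ exp(2πit)`. -/
def addExp (t : ℝ) : ℂ := Complex.exp (2 * Real.pi * Complex.I * t)

theorem addExp_add (s t : ℝ) : addExp (s + t) = addExp s * addExp t := by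
  rw [addExp, addExp, addExp, ← Complex.exp_add]
  push_cast
  ring_nf

theorem addExp_zero : addExp 0 = 1 := by simp [addExp]

theorem addExp_ne_zero (t : ℝ) : addExp t ≠ 0 := Complex.exp_ne_zero _

theorem addExp_eq_one_iff {t : ℝ} : addExp t = 1 ↔ ∃ n : ℤ, t = n := by
  have h0 : (2 * Real.pi * Complex.I : ℂ) ≠ 0 := Complex.two_pi_I_ne_zero
  rw [addExp, Complex.exp_eq_one_iff]
  refine exists_congr fun n => ?_
  rw [mul_comm (n : ℂ), mul_right_inj' h0]
  exact_mod_cast Iff.rfl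

theorem addExp_div_ne_one {v a : ℕ} (hv : 0 < v) (hva : v < a) : addExp (v / a) ≠ 1 := by
  rintro h
  obtain ⟨n, hn⟩ := addExp_eq_one_iff.1 h
  have ha : (0 : ℝ) < a := by exact_mod_cast hv.trans hva
  rw [div_eq_iff ha.ne'] at hn
  have hn' : (v : ℤ) = n * a := by exact_mod_cast hn
  have : (a : ℤ) ∣ v := ⟨n, by rw [hn', mul_comm]⟩
  exact absurd (Nat.le_of_dvd hv (Int.natCast_dvd_natCast.1 this)) (by omega)

@[fun_prop]
theorem continuous_addExp : Continuous addExp := by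
  unfold addExp
  fun_prop

theorem conj_theta (M₁ M₂ : ℕ) (x y : ℝ) :
    (starRingEnd ℂ) (theta M₁ M₂ x y) = addExp (-(M₁ * x)) * addExp (-(M₂ * y)) := by
  rw [← addExp_add, theta, addExp, ← Complex.exp_conj]
  congr 1
  simp only [map_mul, map_add, Complex.conj_ofReal, Complex.conj_I, map_natCast, map_ofNat]
  push_cast
  ring

theorem theta_eq (M₁ M₂ : ℕ) (x y : ℝ) : theta M₁ M₂ x y = addExp (M₁ * x + M₂ * y) := by
  rw [theta, addExp]
  push_cast
  rfl

theorem sum_range_add_of_periodic {M : ℕ} {ψ : ℕ → ℂ} (h : ∀ n, ψ (n + M) = ψ n) (v : ℕ) :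
    ∑ n ∈ Finset.range M, ψ (n + v) = ∑ n ∈ Finset.range M, ψ n := by
  induction v with
  | zero => rfl
  | succ v ih =>
    rw [← ih]
    have h1 := Finset.sum_range_succ (fun n => ψ (n + v)) M
    have h2 := Finset.sum_range_succ' (fun n => ψ (n + v)) M
    have h3 : ψ (M + v) = ψ (0 + v) := by rw [add_comm M, h, zero_add]
    rw [h1, h3] at h2
    rw [add_right_cancel h2]
    exact Finset.sum_congr rfl fun n _ => by rw [add_right_comm, add_assoc]

theorem integral_comp_add_of_periodic {φ : ℝ → ℂ} (h : Function.Periodic φ 1) (c : ℝ) :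
    ∫ x in (0 : ℝ)..1, φ (x + c) = ∫ x in (0 : ℝ)..1, φ x := by
  rw [intervalIntegral.integral_comp_add_right, zero_add, add_comm 1 c,
    h.intervalIntegral_add_eq c 0, zero_add]

theorem integral_comp_mul_add_of_periodic {φ : ℝ → ℂ} (hc : Continuous φ) (h : Function.Periodic φ 1)
    {a : ℕ} (ha : 0 < a) (c : ℝ) : ∫ x in (0 : ℝ)..1, φ (a * x + c) = ∫ x in (0 : ℝ)..1, φ x := by
  have ha' : (a : ℝ) ≠ 0 := by exact_mod_cast ha.ne'
  have h2 := h.intervalIntegral_add_zsmul_eq a c fun _ _ => hc.intervalIntegrable _ _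
  rw [intervalIntegral.integral_comp_mul_add _ ha', mul_zero, zero_add, mul_one, add_comm (a : ℝ) c]
  simp only [zsmul_eq_mul, Int.cast_natCast, mul_one] at h2
  rw [h2, h.intervalIntegral_add_eq c 0, zero_add, Complex.real_smul, ← mul_assoc]
  push_cast
  rw [inv_mul_cancel₀ (by exact_mod_cast ha'), one_mul]

/-- Adding `v` to `x` reindexes the sum by `n ↦ n + v`, harmless because the summand depends on `n`
modulo `M` only. -/
theorem weightedSum_add {M v : ℕ} (hM : 0 < M) {c : ℕ → ℂ} (hcM : ∀ n, c (n + M) = c n)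
    (hcv : ∀ n, c (n + v) = c n) {φ : ℝ → ℂ} (hφ : Function.Periodic φ 1) (d x : ℝ) :
    ∑ n ∈ Finset.range M, c n * φ ((n + (x + v)) / M + d) =
      ∑ n ∈ Finset.range M, c n * φ ((n + x) / M + d) := by
  have hM' : (M : ℝ) ≠ 0 := by exact_mod_cast hM.ne'
  rw [← sum_range_add_of_periodic (ψ := fun n => c n * φ ((n + x) / M + d)) _ v]
  · refine Finset.sum_congr rfl fun n _ => ?_
    rw [hcv]
    push_cast
    ring_nf
  · intro n
    rw [hcM, ← hφ ((n + x) / M + d)]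
    congr 2
    push_cast
    field_simp
    ring

/-- The integral over a period of a periodic weighted sum of translates. -/
theorem integral_weightedSum {M a : ℕ} (hM : 0 < M) (ha : 0 < a) {c : ℕ → ℂ}
    (hcM : ∀ n, c (n + M) = c n) (hca : ∀ n, c (n + a) = c n) {φ : ℝ → ℂ} (hc : Continuous φ)
    (hφ : Function.Periodic φ 1) (d : ℝ) :
    ∫ y in (0 : ℝ)..1, ∑ n ∈ Finset.range M, c n * φ ((n + a * y) / M + d) =
      (∑ n ∈ Finset.range M, c n) * ∫ y in (0 : ℝ)..1, φ y := by
  have hM' : (M : ℝ) ≠ 0 := by exact_mod_cast hM.ne'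
  have hp : Function.Periodic
      (fun y : ℝ => ∑ n ∈ Finset.range M, c n * φ ((n + a * y) / M + d)) 1 := fun y => by
    simp only [mul_add, mul_one]
    exact weightedSum_add hM hcM hca hφ d _
  -- The sum has period 1 by `hca`, so `y` may be replaced by `M y`; each translate then runs
  -- through `a` full periods of `φ`.
  rw [← integral_comp_mul_add_of_periodic (by fun_prop) hp hM 0, intervalIntegral.integral_finsetSum,
    Finset.sum_mul]
  · refine Finset.sum_congr rfl fun n _ => ?_
    rw [intervalIntegral.integral_const_mul, ← integral_comp_mul_add_of_periodic hc hφ ha (n / M + d)]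
    congr 2
    ext y
    congr 1
    field_simp
    ring
  · intro n _
    exact Continuous.intervalIntegrable (by fun_prop) _ _

/-- Translating by `τ` multiplies the integral by `e(-τ) ≠ 1`. -/
theorem integral_mul_addExp_eq_zero {ψ : ℝ → ℂ} {τ : ℝ} (h₁ : Function.Periodic ψ 1)
    (hτ : Function.Periodic ψ τ) (hne : addExp τ ≠ 1) :
    ∫ y in (0 : ℝ)..1, ψ y * addExp (-y) = 0 := by
  have hp : Function.Periodic (fun y => ψ y * addExp (-y)) 1 := fun y => by
    simp only
    rw [h₁, neg_add, addExp_add, (addExp_eq_one_iff (t := -1)).2 ⟨-1, by simp⟩, mul_one]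
  have h := integral_comp_add_of_periodic hp τ
  simp only [hτ _, neg_add, addExp_add, ← mul_assoc] at h
  rw [intervalIntegral.integral_mul_const] at h
  have hi : addExp (-τ) * addExp τ = 1 := by rw [← addExp_add, neg_add_cancel, addExp_zero]
  by_contra h0
  have h1 := mul_left_cancel₀ h0 (h.trans (mul_one _).symm)
  rw [h1, one_mul] at hi
  exact hne hi

/-- The shorter period `v` of the weights gives the sum the period `v/a` in `y`, which the character
does not have. -/
theorem integral_weightedSum_mul_addExp {M a v : ℕ} (hM : 0 < M) (hv : 0 < v) (hva : v < a)
    (hdvd : v ∣ a) {c : ℕ → ℂ} (hcM : ∀ n, c (n + M) = c n) (hcv : ∀ n, c (n + v) = c n)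
    {φ : ℝ → ℂ} (hφ : Function.Periodic φ 1) :
    ∫ y in (0 : ℝ)..1, (∑ n ∈ Finset.range M, c n * φ ((n + a * y) / M)) * addExp (-y) = 0 := by
  have ha' : (a : ℝ) ≠ 0 := by exact_mod_cast (hv.trans hva).ne'
  have hp : Function.Periodic
      (fun y : ℝ => ∑ n ∈ Finset.range M, c n * φ ((n + a * y) / M)) (v / a) := fun y => by
    simp only [mul_add, mul_div_cancel₀ _ ha']
    simpa using weightedSum_add hM hcM hcv hφ 0 (a * y)
  refine integral_mul_addExp_eq_zero ?_ hp (addExp_div_ne_one hv hva)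
  obtain ⟨w, rfl⟩ := hdvd
  have := hp.nat_mul w
  push_cast at ha'
  rwa [show (w * (v / (v * w : ℕ)) : ℝ) = 1 by
    push_cast
    have := left_ne_zero_of_mul ha'
    have := right_ne_zero_of_mul ha'
    field_simp] at this

/-- Unfolding: the translates tile `[0, M]`, which is then rescaled to the unit interval. -/
theorem integral_sum_translates_mul_addExp {M : ℕ} (hM : 0 < M) {φ : ℝ → ℂ} (hc : Continuous φ) :
    ∫ y in (0 : ℝ)..1, (∑ n ∈ Finset.range M, φ ((n + y) / M)) * addExp (-y) =
      M * ∫ x in (0 : ℝ)..1, φ x * addExp (-(M * x)) := by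
  have hM' : (M : ℝ) ≠ 0 := by exact_mod_cast hM.ne'
  have h1 : ∀ n ∈ Finset.range M, ∫ y in (0 : ℝ)..1, φ ((n + y) / M) * addExp (-y) =
      ∫ x in ((n : ℕ) : ℝ)..((n + 1 : ℕ) : ℝ), φ (x / M) * addExp (-x) := fun n _ => by
    have := intervalIntegral.integral_comp_add_left (a := 0) (b := 1)
      (fun x => φ (x / M) * addExp (-x)) (n : ℝ)
    rw [add_zero] at this
    push_cast
    rw [← this]
    congr 1
    ext y
    rw [neg_add, addExp_add, (addExp_eq_one_iff (t := -(n : ℝ))).2 ⟨-n, by simp⟩, one_mul]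
  simp only [Finset.sum_mul]
  rw [intervalIntegral.integral_finsetSum, Finset.sum_congr rfl h1,
    intervalIntegral.sum_integral_adjacent_intervals]
  · have := intervalIntegral.smul_integral_comp_mul_left (a := 0) (b := 1)
      (f := fun x => φ (x / M) * addExp (-x)) (M : ℝ)
    simp only [mul_zero, mul_one, mul_div_cancel_left₀ _ hM'] at this
    rw [Nat.cast_zero, ← this, Complex.real_smul, Complex.ofReal_natCast]
  · intro n _
    exact Continuous.intervalIntegrable (by fun_prop) _ _
  · intro n _
    exact Continuous.intervalIntegrable (by fun_prop) _ _

/-! ### Partial integrals of U(ℤ)-invariant functions. -/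

/-- A continuous function of the coordinates `x₁₂, x₁₃, x₂₃, x₂₄` of `U(ℝ)` that is invariant under
left translation by `U(ℤ)`. -/
structure UInvariant (f : ℝ → ℝ → ℝ → ℝ → ℂ) : Prop where
  continuous : Continuous fun x : ℝ × ℝ × ℝ × ℝ => f x.1 x.2.1 x.2.2.1 x.2.2.2
  add₁₂ : ∀ a b c d, f (a + 1) (b + c) c d = f a b c d
  add₁₃ : ∀ a b c d, f a (b + 1) c d = f a b c d
  add₂₃ : ∀ a b c d, f a (b - a) (c + 1) d = f a b c d
  add₂₄ : ∀ a b c d, f a b (c - a) (d + 1) = f a b c d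

/-- The integral of `f` over the coordinate `x₁₃`. -/
def int₁₃ (f : ℝ → ℝ → ℝ → ℝ → ℂ) (a c d : ℝ) : ℂ := ∫ x in (0 : ℝ)..1, f a x c d

/-- The integral of `f` over the coordinates `x₁₃, x₂₃`. -/
def int₂₃ (f : ℝ → ℝ → ℝ → ℝ → ℂ) (a d : ℝ) : ℂ := ∫ x in (0 : ℝ)..1, int₁₃ f a x d

namespace UInvariant

variable {f : ℝ → ℝ → ℝ → ℝ → ℂ}

theorem int₁₃_shift (hf : UInvariant f) (a b c d : ℝ) :
    ∫ x in (0 : ℝ)..1, f a (x + b) c d = int₁₃ f a c d :=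
  integral_comp_add_of_periodic (φ := fun x => f a x c d) (fun x => hf.add₁₃ a x c d) b

theorem continuous_int₁₃ (hf : UInvariant f) :
    Continuous fun x : ℝ × ℝ × ℝ => int₁₃ f x.1 x.2.1 x.2.2 :=
  intervalIntegral.continuous_parametric_intervalIntegral_of_continuous'
    (f := fun (x : ℝ × ℝ × ℝ) y => f x.1 y x.2.1 x.2.2)
    (hf.continuous.comp (by fun_prop : Continuous fun p : (ℝ × ℝ × ℝ) × ℝ =>
      (p.1.1, p.2, p.1.2.1, p.1.2.2))) 0 1

/-- Integration over x₁₃ absorbs the twist by which a unit step in x₁₂ moves x₁₃. The same mechanism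
yields the later periodicities. -/
theorem int₁₃_add₁₂ (hf : UInvariant f) (a c d : ℝ) : int₁₃ f (a + 1) c d = int₁₃ f a c d := by
  rw [← hf.int₁₃_shift (a + 1) c]
  simp only [hf.add₁₂, int₁₃]

theorem int₁₃_add₂₃ (hf : UInvariant f) (a c d : ℝ) : int₁₃ f a (c + 1) d = int₁₃ f a c d := by
  rw [← hf.int₁₃_shift a (-a)]
  simp only [← sub_eq_add_neg, hf.add₂₃, int₁₃]

theorem int₁₃_add₂₄ (hf : UInvariant f) (a c d : ℝ) :
    int₁₃ f a (c - a) (d + 1) = int₁₃ f a c d := by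
  simp only [hf.add₂₄, int₁₃]

theorem int₂₃_shift (hf : UInvariant f) (a c d : ℝ) :
    ∫ x in (0 : ℝ)..1, int₁₃ f a (x + c) d = int₂₃ f a d :=
  integral_comp_add_of_periodic (φ := fun x => int₁₃ f a x d) (fun x => hf.int₁₃_add₂₃ a x d) c

theorem continuous_int₂₃ (hf : UInvariant f) :
    Continuous fun x : ℝ × ℝ => int₂₃ f x.1 x.2 :=
  intervalIntegral.continuous_parametric_intervalIntegral_of_continuous'
    (f := fun (x : ℝ × ℝ) y => int₁₃ f x.1 y x.2)
    (hf.continuous_int₁₃.comp (by fun_prop : Continuous fun p : (ℝ × ℝ) × ℝ =>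
      (p.1.1, p.2, p.1.2))) 0 1

theorem int₂₃_add₁₂ (hf : UInvariant f) (a d : ℝ) : int₂₃ f (a + 1) d = int₂₃ f a d := by
  simp only [hf.int₁₃_add₁₂, int₂₃]

theorem int₂₃_add₂₄ (hf : UInvariant f) (a d : ℝ) : int₂₃ f a (d + 1) = int₂₃ f a d := by
  rw [← hf.int₂₃_shift a (-a)]
  simp only [← sub_eq_add_neg, hf.int₁₃_add₂₄, int₂₃]

theorem sum_int₁₃ (hf : UInvariant f) {t d₁ : ℕ} (ht : 0 < t) (hd₁ : 0 < d₁) (a b c d : ℝ) :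
    ∫ x in (0 : ℝ)..1, ∑ i ∈ Finset.range d₁, f a ((i + t * x) / d₁ + b) c d =
      d₁ * int₁₃ f a c d := by
  have := integral_weightedSum hd₁ ht (c := fun _ => 1) (fun _ => rfl) (fun _ => rfl)
    (φ := fun x => f a x c d)
    (hf.continuous.comp (by fun_prop : Continuous fun x : ℝ => (a, x, c, d)))
    (fun x => hf.add₁₃ a x c d) b
  simpa [int₁₃] using this

end UInvariant

/-! ### The congruence condition on `j`. -/

/-- The indicator function of the divisibility of `j t₁ + k l` by `t₂`. -/
def dvdInd (t₁ t₂ k l j : ℕ) : ℂ := if t₂ ∣ j * t₁ + k * l then 1 else 0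

theorem dvdInd_add {t₁ t₂ : ℕ} (k l j : ℕ) {v : ℕ} (h : t₂ ∣ v * t₁) :
    dvdInd t₁ t₂ k l (j + v) = dvdInd t₁ t₂ k l j := by
  simp only [dvdInd, show (j + v) * t₁ + k * l = (j * t₁ + k * l) + v * t₁ by ring,
    Nat.dvd_add_left h]

/-- The number of `j` modulo `d₁` such that `j t₁ + k l` is divisible by `t₂`. -/
def solCount (t₁ t₂ d₁ k l : ℕ) : ℂ := ∑ j ∈ Finset.range d₁, dvdInd t₁ t₂ k l j

/-- By Bézout `k v ≡ α t₁` modulo `t₂` for some `α`, so a shift of `l` by `v` amounts to a shift of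
`j` by `α`, invisible in the sum over all `j` modulo `d₁`. -/
theorem solCount_add {t₁ t₂ d₁ k v : ℕ} (ht₂ : 0 < t₂) (hd : t₂ ∣ d₁ * t₁)
    (hv : Nat.gcd t₁ t₂ ∣ k * v) (l : ℕ) :
    solCount t₁ t₂ d₁ k (l + v) = solCount t₁ t₂ d₁ k l := by
  obtain ⟨w, hw⟩ := hv
  obtain ⟨α, hα⟩ : ∃ α : ℕ, (α * t₁ : ℤ) ≡ k * v [ZMOD t₂] := by
    refine ⟨((Nat.gcdA t₁ t₂ * w) % t₂).toNat, ?_⟩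
    rw [Int.toNat_of_nonneg (Int.emod_nonneg _ (by exact_mod_cast ht₂.ne'))]
    refine ((Int.mod_modEq _ _).mul_right _).trans ?_
    have hb := Nat.gcd_eq_gcd_ab t₁ t₂
    rw [show (k * v : ℤ) = Nat.gcd t₁ t₂ * w by exact_mod_cast hw, hb]
    refine Int.modEq_iff_dvd.2 ⟨Nat.gcdB t₁ t₂ * w, by ring⟩
  rw [solCount, solCount, ← sum_range_add_of_periodic (fun n => dvdInd_add k l n hd) α]
  refine Finset.sum_congr rfl fun j _ => ?_
  rw [dvdInd, dvdInd]
  congr 1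
  rw [← Int.natCast_dvd_natCast, ← Int.natCast_dvd_natCast, eq_iff_iff, ← Int.modEq_zero_iff_dvd,
    ← Int.modEq_zero_iff_dvd]
  have h : ((j * t₁ + k * (l + v) : ℕ) : ℤ) ≡ (((j + α) * t₁ + k * l : ℕ) : ℤ) [ZMOD t₂] := by
    push_cast
    rw [show (j * t₁ + k * (l + v) : ℤ) = (j * t₁ + k * l) + k * v by ring,
      show ((j + α) * t₁ + k * l : ℤ) = (j * t₁ + k * l) + α * t₁ by ring]
    exact (hα.symm).add_left _
  exact ⟨fun h' => h.symm.trans h', fun h' => h.trans h'⟩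

theorem solCount_of_coprime {t₁ t₂ d₁ k : ℕ} (ht : t₂ ∣ t₁) (hk : k.Coprime t₂) (l : ℕ) :
    solCount t₁ t₂ d₁ k l = if t₂ ∣ l then (d₁ : ℂ) else 0 := by
  have h : ∀ j, t₂ ∣ j * t₁ + k * l ↔ t₂ ∣ l := fun j => by
    rw [Nat.dvd_add_right (ht.mul_left j), hk.symm.dvd_mul_left]
  simp only [solCount, dvdInd, h]
  split_ifs <;> simp

theorem sum_range_mul_ite {t : ℕ} (ht : 0 < t) (M : ℕ) (h : ℕ → ℂ) :
    ∑ l ∈ Finset.range (t * M), (if t ∣ l then h l else 0) =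
      ∑ n ∈ Finset.range M, h (t * n) := by
  rw [← Finset.sum_filter]
  refine (Finset.sum_nbij' (fun n => t * n) (fun l => l / t) ?_ ?_ ?_ ?_ ?_).symm
  · intro n hn
    simp only [Finset.mem_filter, Finset.mem_range, dvd_mul_right, and_true] at hn ⊢
    exact Nat.mul_lt_mul_of_pos_left hn ht
  · intro l hl
    simp only [Finset.mem_filter, Finset.mem_range] at hl ⊢
    exact Nat.div_lt_of_lt_mul hl.1
  · intro n _
    exact Nat.mul_div_cancel_left _ ht
  · intro l hl
    exact Nat.mul_div_cancel' (Finset.mem_filter.1 hl).2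
  · intro n _
    rfl

/-! ### Which representatives survive the integration. -/

namespace UInvariant

variable {f : ℝ → ℝ → ℝ → ℝ → ℂ}

theorem sum_int₂₃ (hf : UInvariant f) {t₁ t₂ d₁ : ℕ} (k l : ℕ) (ht₂ : 0 < t₂) (hd₁ : 0 < d₁)
    (hd : t₂ ∣ d₁ * t₁) (a b d : ℝ) :
    ∫ x in (0 : ℝ)..1, ∑ j ∈ Finset.range d₁,
        dvdInd t₁ t₂ k l j * int₁₃ f a ((j + t₂ * x) / d₁ + b) d =
      solCount t₁ t₂ d₁ k l * int₂₃ f a d :=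
  integral_weightedSum hd₁ ht₂ (c := dvdInd t₁ t₂ k l) (fun _ => dvdInd_add k l _ hd)
    (fun _ => dvdInd_add k l _ (dvd_mul_right _ _)) (φ := fun x => int₁₃ f a x d)
    (hf.continuous_int₁₃.comp (by fun_prop : Continuous fun x : ℝ => (a, x, d)))
    (fun x => hf.int₁₃_add₂₃ a x d) b

/-- With `g = gcd(t₁, t₂)`, the weights have period `v = g / gcd(g, k)`. This is a proper divisor of
`t₂` unless `t₂ ∣ t₁` and `k` is coprime to `t₂`, so the sum is orthogonal to the character. -/
theorem sum_int₂₄_eq_zero (hf : UInvariant f) {t₁ t₂ d₁ d₂ k m : ℕ} (hm : 0 < m)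
    (h₁ : t₁ * d₁ = m) (h₂ : t₂ * d₂ = m) (hk : t₁ * t₂ ∣ m * k)
    (hne : ¬ (t₂ ∣ t₁ ∧ k.Coprime t₂)) (a : ℝ) :
    ∫ x in (0 : ℝ)..1, (∑ l ∈ Finset.range d₂,
      solCount t₁ t₂ d₁ k l * int₂₃ f a ((l + t₂ * x) / d₂)) * addExp (-x) = 0 := by
  have ht₁ : 0 < t₁ := Nat.pos_of_ne_zero (by rintro rfl; omega)
  have ht₂ : 0 < t₂ := Nat.pos_of_ne_zero (by rintro rfl; omega)
  have hd₂ : 0 < d₂ := Nat.pos_of_ne_zero (by rintro rfl; omega)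
  have hd : t₂ ∣ d₁ * t₁ := ⟨d₂, by linarith⟩
  set g := Nat.gcd t₁ t₂ with hg
  have hg0 : 0 < g := Nat.gcd_pos_of_pos_left _ ht₁
  obtain ⟨v, hv⟩ : Nat.gcd g k ∣ g := Nat.gcd_dvd_left _ _
  have hv0 : 0 < v := Nat.pos_of_ne_zero (by rintro rfl; omega)
  have hvg : v ∣ g := ⟨_, by rw [mul_comm]; exact hv⟩
  have hvt : v ∣ t₂ := hvg.trans (Nat.gcd_dvd_right _ _)
  have hlt : v < t₂ := by
    refine lt_of_le_of_ne (Nat.le_of_dvd ht₂ hvt) fun h => hne ?_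
    have hgt : g = t₂ := Nat.dvd_antisymm (Nat.gcd_dvd_right _ _) (h ▸ hvg)
    refine ⟨hgt ▸ Nat.gcd_dvd_left _ _, ?_⟩
    rw [h, ← hgt] at hv
    have : Nat.gcd g k = 1 := by nlinarith
    rw [← hgt]
    exact (Nat.coprime_comm.1 this)
  refine integral_weightedSum_mul_addExp (c := solCount t₁ t₂ d₁ k) hd₂ hv0 hlt hvt
    (fun l => solCount_add ht₂ hd ?_ l) (fun l => solCount_add ht₂ hd ?_ l)
    (φ := fun x => int₂₃ f a x) (fun x => hf.int₂₃_add₂₄ a x)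
  · refine (Nat.gcd_dvd_left t₁ t₂).trans (Nat.dvd_of_mul_dvd_mul_right ht₂ ?_)
    rwa [show k * d₂ * t₂ = m * k by rw [← h₂]; ring]
  · obtain ⟨k', hk'⟩ := Nat.gcd_dvd_right g k
    refine ⟨k', ?_⟩
    rw [← hg]
    conv_lhs => rw [hk']
    conv_rhs => rw [hv]
    ring

/-- The weight is `d₁` on multiples of `t₂` and zero elsewhere. With `l = t₂ n` the sum becomes the
`M` translates of the unfolding lemma. -/
theorem sum_int₂₄ (hf : UInvariant f) {t₁ t₂ d₁ M k : ℕ} (ht₂ : 0 < t₂) (hM : 0 < M)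
    (ht : t₂ ∣ t₁) (hk : k.Coprime t₂) (a : ℝ) :
    ∫ x in (0 : ℝ)..1, (∑ l ∈ Finset.range (t₂ * M),
      solCount t₁ t₂ d₁ k l * int₂₃ f a ((l + t₂ * x) / (t₂ * M : ℕ))) * addExp (-x) =
      d₁ * (M * ∫ x in (0 : ℝ)..1, int₂₃ f a x * addExp (-(M * x))) := by
  have ht₂' : (t₂ : ℝ) ≠ 0 := by exact_mod_cast ht₂.ne'
  have hM' : (M : ℝ) ≠ 0 := by exact_mod_cast hM.ne'
  rw [← integral_sum_translates_mul_addExp (φ := fun x => int₂₃ f a x) hM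
    (hf.continuous_int₂₃.comp (by fun_prop : Continuous fun x : ℝ => (a, x))),
    ← intervalIntegral.integral_const_mul]
  congr 1
  ext x
  rw [← mul_assoc, Finset.mul_sum]
  congr 1
  simp only [solCount_of_coprime ht hk, ite_mul, zero_mul]
  rw [sum_range_mul_ite ht₂ M fun l => (d₁ : ℂ) * int₂₃ f a ((l + t₂ * x) / (t₂ * M : ℕ))]
  refine Finset.sum_congr rfl fun n _ => ?_
  congr 2
  push_cast
  field_simp

/-- The Whittaker integral of the sum over representatives with given diagonal and given `k`. -/
theorem integral_repSum (hf : UInvariant f) {t₁ t₂ d₁ d₂ k m : ℕ} (hm : 0 < m)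
    (h₁ : t₁ * d₁ = m) (h₂ : t₂ * d₂ = m) (hk : t₁ * t₂ ∣ m * k)
    (A : ℝ → ℝ → ℕ → ℕ → ℝ) (B : ℝ → ℕ → ℝ) :
    ∫ x₁₂ in (0 : ℝ)..1, ∫ x₂₄ in (0 : ℝ)..1, ∫ x₂₃ in (0 : ℝ)..1, ∫ x₁₃ in (0 : ℝ)..1,
      (∑ l ∈ Finset.range d₂, ∑ j ∈ Finset.range d₁, ∑ i ∈ Finset.range d₁,
        dvdInd t₁ t₂ k l j * f ((k + t₁ * x₁₂) / t₂) ((i + t₁ * x₁₃) / d₁ + A x₁₂ x₂₃ l j)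
          ((j + t₂ * x₂₃) / d₁ + B x₁₂ l) ((l + t₂ * x₂₄) / d₂)) *
        (addExp (-x₁₂) * addExp (-x₂₄)) =
      if t₁ = t₂ ∧ k.Coprime t₂ then
        d₁ * d₁ * (d₂ / t₂ : ℕ) * addExp (k / t₂) * ∫ x₁₂ in (0 : ℝ)..1, ∫ x₂₄ in (0 : ℝ)..1,
          int₂₃ f x₁₂ x₂₄ * (addExp (-x₁₂) * addExp (-((d₂ / t₂ : ℕ) * x₂₄)))
      else 0 := by
  have ht₁ : 0 < t₁ := Nat.pos_of_ne_zero (by rintro rfl; omega)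
  have ht₂ : 0 < t₂ := Nat.pos_of_ne_zero (by rintro rfl; omega)
  have hd₁ : 0 < d₁ := Nat.pos_of_ne_zero (by rintro rfl; omega)
  have hd₂ : 0 < d₂ := Nat.pos_of_ne_zero (by rintro rfl; omega)
  have hd : t₂ ∣ d₁ * t₁ := ⟨d₂, by linarith⟩
  have ht₁' : (t₁ : ℝ) ≠ 0 := by exact_mod_cast ht₁.ne'
  have ht₂' : (t₂ : ℝ) ≠ 0 := by exact_mod_cast ht₂.ne'
  have s₁₃ : ∀ a c d : ℝ, Continuous fun x : ℝ => f a x c d := fun a c d =>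
    hf.continuous.comp (by fun_prop : Continuous fun x : ℝ => (a, x, c, d))
  have s₂₃ : ∀ a d : ℝ, Continuous fun x : ℝ => int₁₃ f a x d := fun a d =>
    hf.continuous_int₁₃.comp (by fun_prop : Continuous fun x : ℝ => (a, x, d))
  have e₁₃ : ∀ x₁₂ x₂₄ x₂₃ : ℝ, (∫ x₁₃ in (0 : ℝ)..1,
      (∑ l ∈ Finset.range d₂, ∑ j ∈ Finset.range d₁, ∑ i ∈ Finset.range d₁,
        dvdInd t₁ t₂ k l j * f ((k + t₁ * x₁₂) / t₂) ((i + t₁ * x₁₃) / d₁ + A x₁₂ x₂₃ l j)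
          ((j + t₂ * x₂₃) / d₁ + B x₁₂ l) ((l + t₂ * x₂₄) / d₂)) *
        (addExp (-x₁₂) * addExp (-x₂₄))) =
      d₁ * (∑ l ∈ Finset.range d₂, ∑ j ∈ Finset.range d₁, dvdInd t₁ t₂ k l j *
        int₁₃ f ((k + t₁ * x₁₂) / t₂) ((j + t₂ * x₂₃) / d₁ + B x₁₂ l) ((l + t₂ * x₂₄) / d₂)) *
        (addExp (-x₁₂) * addExp (-x₂₄)) := by
    intro x₁₂ x₂₄ x₂₃
    have hc : ∀ a b c d : ℝ, ∀ l j : ℕ, Continuous fun x : ℝ => ∑ i ∈ Finset.range d₁,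
        dvdInd t₁ t₂ k l j * f a ((i + t₁ * x) / d₁ + b) c d := fun a b c d l j =>
      continuous_finsetSum _ fun i _ => ((s₁₃ a c d).comp (by fun_prop :
        Continuous fun x : ℝ => (i + t₁ * x) / d₁ + b)).const_mul _
    rw [intervalIntegral.integral_mul_const, intervalIntegral.integral_finsetSum, Finset.mul_sum]
    · congr 1
      refine Finset.sum_congr rfl fun l _ => ?_
      rw [intervalIntegral.integral_finsetSum, Finset.mul_sum]
      · refine Finset.sum_congr rfl fun j _ => ?_
        simp only [← Finset.mul_sum]
        rw [intervalIntegral.integral_const_mul, hf.sum_int₁₃ ht₁ hd₁, mul_left_comm]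
      · intro j _
        exact (hc _ _ _ _ _ _).intervalIntegrable _ _
    · intro l _
      exact (continuous_finsetSum _ fun j _ => hc _ _ _ _ _ _).intervalIntegrable _ _
  have e₂₃ : ∀ x₁₂ x₂₄ : ℝ, (∫ x₂₃ in (0 : ℝ)..1,
      d₁ * (∑ l ∈ Finset.range d₂, ∑ j ∈ Finset.range d₁, dvdInd t₁ t₂ k l j *
        int₁₃ f ((k + t₁ * x₁₂) / t₂) ((j + t₂ * x₂₃) / d₁ + B x₁₂ l) ((l + t₂ * x₂₄) / d₂)) *
        (addExp (-x₁₂) * addExp (-x₂₄))) =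
      (d₁ * addExp (-x₁₂)) * ((∑ l ∈ Finset.range d₂, solCount t₁ t₂ d₁ k l *
        int₂₃ f ((k + t₁ * x₁₂) / t₂) ((l + t₂ * x₂₄) / d₂)) * addExp (-x₂₄)) := by
    intro x₁₂ x₂₄
    have hc : ∀ a b d : ℝ, ∀ l : ℕ, Continuous fun x : ℝ => ∑ j ∈ Finset.range d₁,
        dvdInd t₁ t₂ k l j * int₁₃ f a ((j + t₂ * x) / d₁ + b) d := fun a b d l =>
      continuous_finsetSum _ fun j _ => ((s₂₃ a d).comp (by fun_prop :
        Continuous fun x : ℝ => (j + t₂ * x) / d₁ + b)).const_mul _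
    rw [intervalIntegral.integral_mul_const, intervalIntegral.integral_const_mul,
      intervalIntegral.integral_finsetSum]
    · simp only [hf.sum_int₂₃ k _ ht₂ hd₁ hd]
      ring
    · intro l _
      exact (hc _ _ _ _).intervalIntegrable _ _
  simp only [e₁₃, e₂₃, intervalIntegral.integral_const_mul]
  clear e₁₃ e₂₃
  by_cases h : t₂ ∣ t₁ ∧ k.Coprime t₂
  swap
  · rw [if_neg fun h' : t₁ = t₂ ∧ k.Coprime t₂ => h ⟨h'.1 ▸ dvd_rfl, h'.2⟩]
    simp only [hf.sum_int₂₄_eq_zero hm h₁ h₂ hk h, mul_zero, intervalIntegral.integral_zero]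
  obtain ⟨ht, hco⟩ := h
  -- Cancelling `t₂` in `hk` gives `t₁ ∣ k d₂`, and `k` is coprime to `t₂ ∣ t₁`.
  have hdt : t₂ ∣ d₂ := by
    refine hco.symm.dvd_of_dvd_mul_left (ht.trans (Nat.dvd_of_mul_dvd_mul_right ht₂ ?_))
    rwa [show k * d₂ * t₂ = m * k by rw [← h₂]; ring]
  obtain ⟨M, rfl⟩ := hdt
  have hM : 0 < M := Nat.pos_of_ne_zero (by rintro rfl; omega)
  let H : ℝ → ℂ := fun a => ∫ x in (0 : ℝ)..1, int₂₃ f a x * addExp (-(M * x))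
  have e₂₄ : ∀ a, ∫ x in (0 : ℝ)..1, (∑ l ∈ Finset.range (t₂ * M),
      solCount t₁ t₂ d₁ k l * int₂₃ f a ((l + t₂ * x) / (t₂ * M : ℕ))) * addExp (-x) =
      d₁ * (M * H a) := hf.sum_int₂₄ ht₂ hM ht hco
  simp only [e₂₄, Nat.mul_div_cancel_left _ ht₂]
  have hHp : Function.Periodic H 1 := fun a => by simp only [H, hf.int₂₃_add₁₂]
  have hl : ∀ x : ℝ, (d₁ : ℂ) * addExp (-x) * (d₁ * (M * H ((k + t₁ * x) / t₂))) =
      d₁ * d₁ * M * (H ((k + t₁ * x) / t₂) * addExp (-x)) := fun x => by ring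
  have hr : ∀ x : ℝ, ∫ y in (0 : ℝ)..1, int₂₃ f x y * (addExp (-x) * addExp (-(M * y))) =
      H x * addExp (-x) := fun x => by
    rw [← intervalIntegral.integral_mul_const]
    congr 1
    ext y
    ring
  simp only [hl, hr, intervalIntegral.integral_const_mul]
  obtain ⟨s, rfl⟩ := ht
  have hs : 0 < s := Nat.pos_of_ne_zero (by rintro rfl; omega)
  have hs' : (s : ℝ) ≠ 0 := by exact_mod_cast hs.ne'
  have hz : ∀ x : ℝ, (k + (t₂ * s : ℕ) * x) / t₂ = s * x + k / t₂ := fun x => by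
    push_cast
    field_simp
    ring
  simp only [hz]
  -- Here `t₁ = t₂ s`. For `s = 1` the translation of x₁₂ by `k/t₂` produces the phase `e(k/t₂)`;
  -- for `s > 1` the function has period `1/s` and is orthogonal to the character.
  split_ifs with h
  · obtain rfl : s = 1 := Nat.eq_of_mul_eq_mul_left ht₂ (h.1.trans (mul_one _).symm)
    rw [mul_assoc _ (addExp _)]
    congr 1
    have hp : Function.Periodic (fun x => H x * addExp (-x)) 1 := fun x => by
      simp only
      rw [hHp, neg_add, addExp_add, (addExp_eq_one_iff (t := -1)).2 ⟨-1, by simp⟩, mul_one]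
    rw [← integral_comp_add_of_periodic hp (k / t₂), ← intervalIntegral.integral_const_mul]
    congr 1
    ext x
    have : addExp (k / t₂) * addExp (-(k / t₂)) = 1 := by
      rw [← addExp_add, add_neg_cancel, addExp_zero]
    rw [neg_add, addExp_add, Nat.cast_one, one_mul]
    linear_combination (-H (x + k / t₂) * addExp (-x)) * this
  · have hs1 : 1 < s := by
      rcases Nat.lt_or_ge 1 s with h' | h'
      · exact h'
      · exact absurd ⟨by rw [show s = 1 by omega, mul_one], hco⟩ h
    have hp : Function.Periodic (fun x : ℝ => H (s * x + k / t₂)) (1 / s) := fun x => by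
      simp only
      rw [mul_add, mul_one_div_cancel hs', add_right_comm, hHp]
    rw [integral_mul_addExp_eq_zero (τ := 1 / s) ?_ hp, mul_zero]
    · have := addExp_div_ne_one one_pos hs1
      rwa [Nat.cast_one] at this
    · have := hp.nat_mul s
      rwa [mul_one_div_cancel hs'] at this

end UInvariant

/-! ### The Whittaker integral of `T(m)ϖ`. -/

theorem exists_toReal_eq_unip (q : ℕ) (a b c d : ℤ) :
    ∃ γ ∈ Gamma0 q, toReal γ = unip a b c d := by
  obtain ⟨γ, hγ, h⟩ := exists_mem_Gamma0 q (a₁₁ := 1) (a₁₂ := a) (a₂₁ := 0) (a₂₂ := 1)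
    (b₁₁ := b) (b₁₂ := c + a * d) (b₂₁ := c) (b₂₂ := d) (c₁₁ := 0) (c₁₂ := 0) (c₂₁ := 0)
    (c₂₂ := 0) (d₁₁ := 1) (d₁₂ := 0) (d₂₁ := -a) (d₂₂ := 1)
    (by refine ⟨?_, ?_, ?_, ?_, ?_, ?_⟩ <;> linarith)
    (by simp) (by simp) (by simp) (by simp)
  refine ⟨γ, hγ, Subtype.ext ?_⟩
  simp only [toReal, h, unip]
  rw [Matrix.fromBlocks_map]
  congr 1 <;> ext i j <;> fin_cases i <;> fin_cases j <;> simp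

section

variable {q : ℕ} {ϖ : Sp4 → ℂ}

theorem apply_unip_int_mul (hϖ : ∀ γ ∈ Gamma0 q, ∀ g, ϖ (toReal γ * g) = ϖ g) (a b c d : ℤ)
    (g : Sp4) : ϖ (unip a b c d * g) = ϖ g := by
  obtain ⟨γ, hγ, h⟩ := exists_toReal_eq_unip q a b c d
  rw [← h, hϖ γ hγ]

theorem uInvariant (hc : Continuous ϖ) (hϖ : ∀ γ ∈ Gamma0 q, ∀ g, ϖ (toReal γ * g) = ϖ g)
    (g : Sp4) : UInvariant fun a b c d => ϖ (unip a b c d * g) where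
  continuous := hc.comp (continuous_unip.mul continuous_const)
  add₁₂ a b c d := by
    rw [← apply_unip_int_mul hϖ 1 0 0 0 (unip a b c d * g), ← mul_assoc, unip_mul]
    congr 3 <;> push_cast <;> ring
  add₁₃ a b c d := by
    rw [← apply_unip_int_mul hϖ 0 1 0 0 (unip a b c d * g), ← mul_assoc, unip_mul]
    congr 3 <;> push_cast <;> ring
  add₂₃ a b c d := by
    rw [← apply_unip_int_mul hϖ 0 0 1 0 (unip a b c d * g), ← mul_assoc, unip_mul]
    congr 3 <;> push_cast <;> ring
  add₂₄ a b c d := by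
    rw [← apply_unip_int_mul hϖ 0 0 0 1 (unip a b c d * g), ← mul_assoc, unip_mul]
    congr 3 <;> push_cast <;> ring

theorem whittakerIntegral_one_left (ϖ : Sp4 → ℂ) (M : ℕ) (g : Sp4) :
    whittakerIntegral ϖ 1 M g = ∫ x₁₂ in (0 : ℝ)..1, ∫ x₂₄ in (0 : ℝ)..1,
      int₂₃ (fun a b c d => ϖ (unip a b c d * g)) x₁₂ x₂₄ *
        (addExp (-x₁₂) * addExp (-(M * x₂₄))) := by
  simp only [whittakerIntegral, conj_theta, Nat.cast_one, one_mul,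
    intervalIntegral.integral_mul_const, int₂₃, int₁₃]

/-- The integral over the unit cube, in the order of integration used for Whittaker integrals. -/
def cubeIntegral (F : ℝ → ℝ → ℝ → ℝ → ℂ) : ℂ :=
  ∫ x₁₂ in (0 : ℝ)..1, ∫ x₂₄ in (0 : ℝ)..1, ∫ x₂₃ in (0 : ℝ)..1, ∫ x₁₃ in (0 : ℝ)..1,
    F x₁₂ x₁₃ x₂₃ x₂₄

theorem continuous_integral {X : Type*} [TopologicalSpace X] {F : X → ℝ → ℂ}
    (h : Continuous fun p : X × ℝ => F p.1 p.2) : Continuous fun x => ∫ y in (0 : ℝ)..1, F x y :=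
  intervalIntegral.continuous_parametric_intervalIntegral_of_continuous' h 0 1

theorem cubeIntegral_sum {ι : Type*} (s : Finset ι) (F : ι → ℝ → ℝ → ℝ → ℝ → ℂ)
    (hF : ∀ n ∈ s, Continuous fun x : ℝ × ℝ × ℝ × ℝ => F n x.1 x.2.1 x.2.2.1 x.2.2.2) :
    cubeIntegral (fun a b c d => ∑ n ∈ s, F n a b c d) = ∑ n ∈ s, cubeIntegral (F n) := by
  have h₁ : ∀ n ∈ s, Continuous fun x : ℝ × ℝ × ℝ =>
      ∫ x₁₃ in (0 : ℝ)..1, F n x.1 x₁₃ x.2.2 x.2.1 := fun n hn =>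
    continuous_integral (F := fun (x : ℝ × ℝ × ℝ) x₁₃ => F n x.1 x₁₃ x.2.2 x.2.1)
      ((hF n hn).comp (by fun_prop : Continuous fun p : (ℝ × ℝ × ℝ) × ℝ =>
        (p.1.1, p.2, p.1.2.2, p.1.2.1)))
  have h₂ : ∀ n ∈ s, Continuous fun x : ℝ × ℝ =>
      ∫ x₂₃ in (0 : ℝ)..1, ∫ x₁₃ in (0 : ℝ)..1, F n x.1 x₁₃ x₂₃ x.2 := fun n hn =>
    continuous_integral (F := fun (x : ℝ × ℝ) x₂₃ => ∫ x₁₃ in (0 : ℝ)..1, F n x.1 x₁₃ x₂₃ x.2)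
      ((h₁ n hn).comp (by fun_prop : Continuous fun p : (ℝ × ℝ) × ℝ => (p.1.1, p.1.2, p.2)))
  have h₃ : ∀ n ∈ s, Continuous fun x : ℝ => ∫ x₂₄ in (0 : ℝ)..1,
      ∫ x₂₃ in (0 : ℝ)..1, ∫ x₁₃ in (0 : ℝ)..1, F n x x₁₃ x₂₃ x₂₄ := fun n hn =>
    continuous_integral (F := fun (x : ℝ) x₂₄ => ∫ x₂₃ in (0 : ℝ)..1, ∫ x₁₃ in (0 : ℝ)..1,
      F n x x₁₃ x₂₃ x₂₄) (h₂ n hn)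
  have e₁ : ∀ a c d : ℝ, ∫ x in (0 : ℝ)..1, ∑ n ∈ s, F n a x c d =
      ∑ n ∈ s, ∫ x in (0 : ℝ)..1, F n a x c d := fun a c d =>
    intervalIntegral.integral_finsetSum fun n hn => (((hF n hn).comp (by fun_prop :
      Continuous fun x : ℝ => (a, x, c, d))).intervalIntegrable _ _)
  have e₂ : ∀ a d : ℝ, ∫ y in (0 : ℝ)..1, ∑ n ∈ s, ∫ x in (0 : ℝ)..1, F n a x y d =
      ∑ n ∈ s, ∫ y in (0 : ℝ)..1, ∫ x in (0 : ℝ)..1, F n a x y d := fun a d =>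
    intervalIntegral.integral_finsetSum fun n hn => (((h₁ n hn).comp (by fun_prop :
      Continuous fun y : ℝ => (a, d, y))).intervalIntegrable _ _)
  have e₃ : ∀ a : ℝ, ∫ z in (0 : ℝ)..1, ∑ n ∈ s, ∫ y in (0 : ℝ)..1, ∫ x in (0 : ℝ)..1,
      F n a x y z = ∑ n ∈ s, ∫ z in (0 : ℝ)..1, ∫ y in (0 : ℝ)..1, ∫ x in (0 : ℝ)..1,
        F n a x y z := fun a =>
    intervalIntegral.integral_finsetSum fun n hn => (((h₂ n hn).comp (by fun_prop :
      Continuous fun z : ℝ => (a, z))).intervalIntegrable _ _)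
  simp only [cubeIntegral, e₁, e₂, e₃]
  exact intervalIntegral.integral_finsetSum fun n hn => (h₃ n hn).intervalIntegrable _ _

theorem sum_repSet (m : ℕ) (F : (Σ _ : ℕ × ℕ, ℕ × ℕ × ℕ × ℕ) → ℂ) :
    ∑ x ∈ repSet m, F x = ∑ n ∈ ((m.divisors ×ˢ m.divisors).sigma fun t =>
        (Finset.range t.2).filter fun k => t.1 * t.2 ∣ m * k),
      ∑ l ∈ Finset.range (m / n.1.2), ∑ j ∈ Finset.range (m / n.1.1),
        ∑ i ∈ Finset.range (m / n.1.1), dvdInd n.1.1 n.1.2 n.2 l j * F ⟨n.1, n.2, l, j, i⟩ := by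
  rw [repSet, Finset.sum_filter, Finset.sum_sigma, Finset.sum_sigma]
  refine Finset.sum_congr rfl fun t _ => ?_
  simp only [Finset.sum_product, Finset.sum_filter]
  refine Finset.sum_congr rfl fun k _ => ?_
  split_ifs with h
  · simp only [h, true_and, dvdInd, ite_mul, one_mul, zero_mul]
  · simp [h]

theorem whittakerIntegral_heckeOperator (hc : Continuous ϖ)
    (hϖ : ∀ γ ∈ Gamma0 q, ∀ g, ϖ (toReal γ * g) = ϖ g) {m : ℕ} (hm : 0 < m) (hmq : m.Coprime q)
    (g : Sp4) :
    whittakerIntegral (heckeOperator q m ϖ) 1 1 g =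
      ∑ n ∈ ((m.divisors ×ˢ m.divisors).sigma fun t =>
        (Finset.range t.2).filter fun k => t.1 * t.2 ∣ m * k),
      if n.1.1 = n.1.2 ∧ n.2.Coprime n.1.2 then
        (m / n.1.1 : ℕ) * (m / n.1.1 : ℕ) * (m / n.1.2 / n.1.2 : ℕ) * addExp (n.2 / n.1.2) *
          whittakerIntegral ϖ 1 (m / n.1.2 / n.1.2) (iota (n.1.1 / n.1.2) (n.1.2 ^ 2 / m) * g)
      else 0 := by
  have h : whittakerIntegral (heckeOperator q m ϖ) 1 1 g =
      cubeIntegral fun a b c d => ∑ n ∈ ((m.divisors ×ˢ m.divisors).sigma fun t =>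
        (Finset.range t.2).filter fun k => t.1 * t.2 ∣ m * k),
      (∑ l ∈ Finset.range (m / n.1.2), ∑ j ∈ Finset.range (m / n.1.1),
        ∑ i ∈ Finset.range (m / n.1.1), dvdInd n.1.1 n.1.2 n.2 l j *
          ϖ (repSp m ⟨n.1, n.2, l, j, i⟩ * (unip a b c d * g))) *
        (addExp (-a) * addExp (-d)) := by
    simp only [whittakerIntegral, heckeOperator_eq_sum hmq hϖ, conj_theta, sum_repSet,
      cubeIntegral, Finset.sum_mul, Nat.cast_one, one_mul]
  rw [h, cubeIntegral_sum]
  · refine Finset.sum_congr rfl fun n hn => ?_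
    obtain ⟨⟨t₁, t₂⟩, k⟩ := n
    simp only [Finset.mem_sigma, Finset.mem_product, Nat.mem_divisors, Finset.mem_filter,
      Finset.mem_range] at hn ⊢
    obtain ⟨⟨⟨ht₁, -⟩, ht₂, -⟩, -, hk⟩ := hn
    have h₁ : t₁ * (m / t₁) = m := Nat.mul_div_cancel' ht₁
    have h₂ : t₂ * (m / t₂) = m := Nat.mul_div_cancel' ht₂
    -- The two functions supplied are the shifts of x₁₃ and x₂₃ from `unip_mul_iota_mul_unip`.
    have key := (uInvariant hc hϖ (iota (t₁ / t₂) (t₂ ^ 2 / m) * g)).integral_repSum hm h₁ h₂ hk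
      (fun x₁₂ x₂₃ l j => k / t₂ * (t₂ * x₂₃ / (m / t₁ : ℕ)) - j / (m / t₁ : ℕ) *
        (t₁ / t₂ * x₁₂) - k / t₂ * (l / (m / t₂ : ℕ)) * (t₁ / t₂ * x₁₂))
      (fun x₁₂ l => -(l / (m / t₂ : ℕ) * (t₁ / t₂ * x₁₂)))
    rw [← whittakerIntegral_one_left] at key
    rw [← key, cubeIntegral]
    have hu : ∀ (l j i : ℕ) (x₁₂ x₁₃ x₂₃ x₂₄ : ℝ), repSp m ⟨(t₁, t₂), k, l, j, i⟩ *
        (unip x₁₂ x₁₃ x₂₃ x₂₄ * g) =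
          unip ((k + t₁ * x₁₂) / t₂) ((i + t₁ * x₁₃) / (m / t₁ : ℕ) +
            (k / t₂ * (t₂ * x₂₃ / (m / t₁ : ℕ)) - j / (m / t₁ : ℕ) *
              (t₁ / t₂ * x₁₂) - k / t₂ * (l / (m / t₂ : ℕ)) * (t₁ / t₂ * x₁₂)))
            ((j + t₂ * x₂₃) / (m / t₁ : ℕ) + -(l / (m / t₂ : ℕ) * (t₁ / t₂ * x₁₂)))
            ((l + t₂ * x₂₄) / (m / t₂ : ℕ)) * (iota (t₁ / t₂) (t₂ ^ 2 / m) * g) :=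
        fun l j i x₁₂ x₁₃ x₂₃ x₂₄ => by
      rw [← mul_assoc, repSp, unip_mul_iota_mul_unip m t₁ t₂ k i j l (m / t₁ : ℕ) (m / t₂ : ℕ)
        (by exact_mod_cast hm) (by exact_mod_cast Nat.pos_of_dvd_of_pos ht₁ hm)
        (by exact_mod_cast Nat.pos_of_dvd_of_pos ht₂ hm) (by exact_mod_cast h₁)
        (by exact_mod_cast h₂), mul_assoc]
    simp only [hu]
  · intro n _
    refine Continuous.mul ?_ (by fun_prop)
    refine continuous_finsetSum _ fun l _ => continuous_finsetSum _ fun j _ =>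
      continuous_finsetSum _ fun i _ => ?_
    exact (hc.comp (continuous_const.mul (continuous_unip.mul continuous_const))).const_mul _

/-! ### Ramanujan sums and prime power level of the Hecke operator. -/

/-- The sum of the primitive `t`-th roots of unity. -/
def primitiveSum (t : ℕ) : ℂ := ∑ k ∈ Finset.range t, if k.Coprime t then addExp (k / t) else 0

/-- On the surviving diagonal `t₁ = t₂ = t`, coprimality of `k` and `t` turns `t² ∣ m k` into `t² ∣
m`. The remaining sum over `k` is a Ramanujan sum. -/
theorem whittakerIntegral_heckeOperator_eq (hc : Continuous ϖ)
    (hϖ : ∀ γ ∈ Gamma0 q, ∀ g, ϖ (toReal γ * g) = ϖ g) {m : ℕ} (hm : 0 < m) (hmq : m.Coprime q)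
    (g : Sp4) :
    whittakerIntegral (heckeOperator q m ϖ) 1 1 g = ∑ t ∈ m.divisors, if t * t ∣ m then
      (m / t : ℕ) * (m / t : ℕ) * (m / t / t : ℕ) * primitiveSum t *
        whittakerIntegral ϖ 1 (m / t / t) (iota 1 (t ^ 2 / m) * g) else 0 := by
  rw [whittakerIntegral_heckeOperator hc hϖ hm hmq, Finset.sum_sigma, Finset.sum_product]
  refine Finset.sum_congr rfl fun t ht => ?_
  have ht0 : (t : ℝ) ≠ 0 := by exact_mod_cast (Nat.pos_of_mem_divisors ht).ne'
  rw [Finset.sum_eq_single t]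
  · rw [Finset.sum_filter]
    simp only [true_and, div_self ht0]
    rw [primitiveSum]
    have hco : ∀ k : ℕ, k.Coprime t → (t * t ∣ m * k ↔ t * t ∣ m) := fun k hk =>
      (Nat.Coprime.mul_left hk.symm hk.symm).dvd_mul_right
    split_ifs with h
    · rw [Finset.mul_sum, Finset.sum_mul]
      refine Finset.sum_congr rfl fun k _ => ?_
      rw [if_pos (h.mul_right k)]
      split_ifs <;> simp
    · refine Finset.sum_eq_zero fun k _ => ?_
      split_ifs with h₁ h₂
      · exact absurd ((hco k h₂).1 h₁) h
      · rfl
      · rfl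
  · intro t' _ hne
    exact Finset.sum_eq_zero fun k _ => if_neg fun h => hne h.1.symm
  · intro h
    exact absurd ht h

theorem primitiveSum_one : primitiveSum 1 = 1 := by
  simp [primitiveSum, addExp_zero]

theorem sum_eq_zero_of_shift {M v : ℕ} (hM : 0 < M) (hv : 0 < v) (hvM : v < M) {c : ℕ → ℂ}
    (hcM : ∀ n, c (n + M) = c n) (hcv : ∀ n, c (n + v) = c n) :
    ∑ n ∈ Finset.range M, c n * addExp (n / M) = 0 := by
  have hM' : (M : ℝ) ≠ 0 := by exact_mod_cast hM.ne'
  have h := sum_range_add_of_periodic (M := M) (ψ := fun n => c n * addExp (n / M))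
    (fun n => by
      rw [hcM, Nat.cast_add, add_div, div_self hM', addExp_add,
        (addExp_eq_one_iff (t := 1)).2 ⟨1, by simp⟩, mul_one]) v
  simp only [hcv, Nat.cast_add, add_div, addExp_add, ← mul_assoc] at h
  rw [← Finset.sum_mul] at h
  by_contra h0
  exact addExp_div_ne_one hv hvM (mul_left_cancel₀ h0 (h.trans (mul_one _).symm))

theorem primitiveSum_prime {p : ℕ} (hp : p.Prime) : primitiveSum p = -1 := by
  have h := sum_eq_zero_of_shift hp.pos one_pos hp.one_lt (c := fun _ => 1) (fun _ => rfl)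
    fun _ => rfl
  simp only [one_mul] at h
  obtain ⟨n, rfl⟩ : ∃ n, p = n + 1 := ⟨p - 1, by have := hp.pos; omega⟩
  rw [Finset.sum_range_succ'] at h
  rw [primitiveSum, Finset.sum_range_succ', if_neg]
  · rw [eq_neg_iff_add_eq_zero, add_zero, ← h]
    congr 1
    · refine Finset.sum_congr rfl fun k hk => if_pos ?_
      exact (Nat.coprime_comm.1 (Nat.coprime_of_lt_prime (Nat.succ_ne_zero k)
        (by simpa using hk) hp))
    · simp [addExp_zero]
  · simpa using hp.ne_one

/-- For `b ≥ 2` coprimality to `p^b` already has period `p^(b-1)`, and shifting by it multiplies the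
sum by a nontrivial root of unity. -/
theorem primitiveSum_prime_pow {p b : ℕ} (hp : p.Prime) (hb : 2 ≤ b) :
    primitiveSum (p ^ b) = 0 := by
  have hco : ∀ k : ℕ, k.Coprime (p ^ b) ↔ ¬ p ∣ k := fun k => by
    rw [Nat.coprime_pow_right_iff (by omega), Nat.coprime_comm, hp.coprime_iff_not_dvd]
  have h := sum_eq_zero_of_shift (M := p ^ b) (v := p ^ (b - 1)) (Nat.pow_pos hp.pos)
    (Nat.pow_pos hp.pos) (Nat.pow_lt_pow_right hp.one_lt (by omega))
    (c := fun k => if p ∣ k then 0 else 1)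
    (fun n => by simp only [Nat.dvd_add_left (dvd_pow_self p (by omega : b ≠ 0))])
    (fun n => by simp only [Nat.dvd_add_left (dvd_pow_self p (by omega : b - 1 ≠ 0))])
  rw [← h, primitiveSum]
  refine Finset.sum_congr rfl fun k _ => ?_
  simp only [hco]
  split_ifs <;> simp

theorem whittakerIntegral_heckeOperator_prime (hc : Continuous ϖ)
    (hϖ : ∀ γ ∈ Gamma0 q, ∀ g, ϖ (toReal γ * g) = ϖ g) {p : ℕ} (hp : p.Prime)
    (hpq : p.Coprime q) (g : Sp4) :
    whittakerIntegral (heckeOperator q p ϖ) 1 1 g =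
      (p : ℂ) ^ 3 * whittakerIntegral ϖ 1 p (iota 1 (1 / p) * g) := by
  rw [whittakerIntegral_heckeOperator_eq hc hϖ hp.pos hpq, hp.divisors,
    Finset.sum_pair hp.one_lt.ne, if_neg (c := p * p ∣ p)]
  · simp only [primitiveSum_one, one_dvd, if_true, Nat.div_one, Nat.cast_one, one_pow,
      mul_one, add_zero]
    ring
  · intro h
    have := Nat.le_of_dvd hp.pos h
    have := hp.two_le
    nlinarith

/-- Only `t = 1` and `t = p` contribute; the latter has coefficient `-(p^(r+1))² p^r = -p² (p^r)³`.
-/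
theorem whittakerIntegral_heckeOperator_prime_pow (hc : Continuous ϖ)
    (hϖ : ∀ γ ∈ Gamma0 q, ∀ g, ϖ (toReal γ * g) = ϖ g) {p : ℕ} (hp : p.Prime)
    (hpq : p.Coprime q) (r : ℕ) (g : Sp4) :
    whittakerIntegral (heckeOperator q (p ^ (r + 2)) ϖ) 1 1 g =
      ((p ^ (r + 2) : ℕ) : ℂ) ^ 3 *
        whittakerIntegral ϖ 1 (p ^ (r + 2)) (iota 1 (1 / (p ^ (r + 2) : ℕ)) * g) -
      (p : ℂ) ^ 2 * ((p ^ r : ℕ) : ℂ) ^ 3 *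
        whittakerIntegral ϖ 1 (p ^ r) (iota 1 (p ^ 2 / (p ^ (r + 2) : ℕ)) * g) := by
  have h₁ : p ^ (r + 2) / p / p = p ^ r := by
    rw [Nat.div_div_eq_div_mul, pow_add, pow_two,
      Nat.mul_div_cancel _ (Nat.mul_pos hp.pos hp.pos)]
  have h₂ : p ^ (r + 2) / p = p ^ r * p := by
    rw [← add_assoc r 1 1, pow_succ, Nat.mul_div_cancel _ hp.pos, pow_succ]
  rw [whittakerIntegral_heckeOperator_eq hc hϖ (Nat.pow_pos hp.pos) (hpq.pow_left _),
    Nat.sum_divisors_prime_pow hp, Finset.sum_range_succ', Finset.sum_range_succ',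
    Finset.sum_eq_zero]
  · rw [zero_add, pow_one, if_pos, pow_zero, if_pos, h₁, h₂, primitiveSum_prime hp,
      primitiveSum_one]
    · simp
      ring
    · simp
    · exact ⟨p ^ r, by ring⟩
  · intro b _
    rw [primitiveSum_prime_pow hp (by omega)]
    simp

end

/-! ### From Whittaker integrals to Fourier coefficients. -/

/-- `ϖ_{(1, M)}` is `b` times the standard Whittaker function for the character `θ_{(1, M)}`. -/
def IsWhittakerMultiple (μ₁ μ₂ : ℂ) (ϖ : Sp4 → ℂ) (M : ℕ) (b : ℂ) : Prop :=
  ∀ x₁₂ x₁₃ x₂₃ x₂₄ y₁ y₂ : ℝ, 0 < y₁ → 0 < y₂ → ∀ k ∈ K,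
    whittakerIntegral ϖ 1 M (unip x₁₂ x₁₃ x₂₃ x₂₄ * iota y₁ y₂ * k) =
      b * addExp (x₁₂ + M * x₂₄) * whittaker μ₁ μ₂ y₁ (M * y₂)

section

variable {q : ℕ} {μ₁ μ₂ : ℂ} {ϖ : Sp4 → ℂ}

theorem isFourierCoeff_one_iff {M : ℕ} {a : ℂ} : IsFourierCoeff μ₁ μ₂ ϖ 1 M a ↔
    IsWhittakerMultiple μ₁ μ₂ ϖ M (a / (((M : ℝ) ^ (3 / 2 : ℝ) : ℝ) : ℂ)) := by
  simp only [IsFourierCoeff, IsWhittakerMultiple, theta_eq, Nat.cast_one, one_mul, one_pow]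

theorem fourierCoeff_eq_of_existsUnique {M₁ M₂ : ℕ} {a : ℂ}
    (h : IsFourierCoeff μ₁ μ₂ ϖ M₁ M₂ a) (hu : ∀ b, IsFourierCoeff μ₁ μ₂ ϖ M₁ M₂ b → b = a) :
    fourierCoeff μ₁ μ₂ ϖ M₁ M₂ = a := by
  have hex : ∃! b, IsFourierCoeff μ₁ μ₂ ϖ M₁ M₂ b := ⟨a, h, hu⟩
  rw [fourierCoeff, dif_pos hex]
  exact hu _ hex.choose_spec.1

/-- The default value of `fourierCoeff` is 0, so the value 1 certifies existence and uniqueness.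
Were the Whittaker function identically zero, 0 would be a second admissible constant. -/
theorem isFourierCoeff_one_one (hA : fourierCoeff μ₁ μ₂ ϖ 1 1 = 1) :
    IsFourierCoeff μ₁ μ₂ ϖ 1 1 1 ∧
      ∃ y₁ y₂ : ℝ, 0 < y₁ ∧ 0 < y₂ ∧ whittaker μ₁ μ₂ y₁ y₂ ≠ 0 := by
  have hex : ∃! a, IsFourierCoeff μ₁ μ₂ ϖ 1 1 a := by
    by_contra h
    rw [fourierCoeff, dif_neg h] at hA
    exact zero_ne_one hA
  rw [fourierCoeff, dif_pos hex] at hA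
  have h1 : IsFourierCoeff μ₁ μ₂ ϖ 1 1 1 := hA ▸ hex.choose_spec.1
  refine ⟨h1, ?_⟩
  by_contra! h
  refine zero_ne_one (hex.unique (y₁ := 0) ?_ h1)
  intro x₁₂ x₁₃ x₂₃ x₂₄ y₁ y₂ hy₁ hy₂ k hk
  rw [h1 x₁₂ x₁₃ x₂₃ x₂₄ y₁ y₂ hy₁ hy₂ k hk, h _ _ (by simpa using hy₁) (by simpa using hy₂),
    mul_zero, mul_zero]

theorem fourierCoeff_one_eq {M : ℕ} (hM : 0 < M)
    (hW : ∃ y₁ y₂ : ℝ, 0 < y₁ ∧ 0 < y₂ ∧ whittaker μ₁ μ₂ y₁ y₂ ≠ 0) {b : ℂ}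
    (hb : IsWhittakerMultiple μ₁ μ₂ ϖ M b) :
    fourierCoeff μ₁ μ₂ ϖ 1 M = b * (((M : ℝ) ^ (3 / 2 : ℝ) : ℝ) : ℂ) := by
  have hM' : (0 : ℝ) < M := by exact_mod_cast hM
  have h0 : (((M : ℝ) ^ (3 / 2 : ℝ) : ℝ) : ℂ) ≠ 0 := by
    exact_mod_cast (Real.rpow_pos_of_pos hM' _).ne'
  refine fourierCoeff_eq_of_existsUnique
    (isFourierCoeff_one_iff.2 (by rwa [mul_div_cancel_right₀ _ h0])) fun a ha => ?_
  obtain ⟨y₁, y₂, hy₁, hy₂, hW⟩ := hW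
  have h1 : (1 : Sp4) ∈ K := by simp [K]
  -- Dividing `y₂` by `M` puts the evaluation at the point where the Whittaker function is nonzero.
  have e₁ := isFourierCoeff_one_iff.1 ha 0 0 0 0 y₁ (y₂ / M) hy₁ (by positivity) 1 h1
  have e₂ := hb 0 0 0 0 y₁ (y₂ / M) hy₁ (by positivity) 1 h1
  rw [e₂, mul_div_cancel₀ _ hM'.ne'] at e₁
  have := mul_right_cancel₀ (addExp_ne_zero _) (mul_right_cancel₀ hW e₁)
  rw [this, div_mul_cancel₀ _ h0]

theorem iota_one_mul (c x₁₂ x₁₃ x₂₃ x₂₄ y₁ y₂ : ℝ) (k : Sp4) (hc : 0 < c) (hy₁ : 0 < y₁)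
    (hy₂ : 0 < y₂) :
    iota 1 c * (unip x₁₂ x₁₃ x₂₃ x₂₄ * iota y₁ y₂ * k) =
      unip x₁₂ (c * x₁₃) (c * x₂₃) (c * x₂₄) * iota y₁ (c * y₂) * k := by
  rw [← mul_assoc, ← mul_assoc, iota_mul_unip _ _ _ _ _ _ one_pos hc, mul_assoc (unip _ _ _ _),
    iota_mul_iota _ _ _ _ one_pos hc hy₁ hy₂]
  simp only [one_mul, one_pow]

theorem iota_one_mul_iota_one_mul {c c' : ℝ} (g : Sp4) (hc : 0 < c) (hc' : 0 < c') :
    iota 1 c * (iota 1 c' * g) = iota 1 (c * c') * g := by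
  rw [← mul_assoc, iota_mul_iota _ _ _ _ one_pos hc one_pos hc', one_mul]

theorem heckeOperator_eq_heckeEigenvalue {m : ℕ}
    (h : ∃ c : ℂ, ∀ g, heckeOperator q m ϖ g = c * ϖ g) :
    heckeOperator q m ϖ = fun g => heckeEigenvalue q m ϖ * ϖ g :=
  funext (Classical.epsilon_spec h)

theorem whittakerIntegral_const_mul (c : ℂ) (M₁ M₂ : ℕ) (g : Sp4) :
    whittakerIntegral (fun g => c * ϖ g) M₁ M₂ g = c * whittakerIntegral ϖ M₁ M₂ g := by
  simp only [whittakerIntegral, mul_assoc, intervalIntegral.integral_const_mul]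

theorem isWhittakerMultiple_prime (hϖ : IsCuspidalEigenform q μ₁ μ₂ ϖ)
    (h₁ : IsWhittakerMultiple μ₁ μ₂ ϖ 1 1) {p : ℕ} (hp : p.Prime) (hpq : p.Coprime q) :
    IsWhittakerMultiple μ₁ μ₂ ϖ p (heckeEigenvalue q p ϖ / (p : ℂ) ^ 3) := by
  intro x₁₂ x₁₃ x₂₃ x₂₄ y₁ y₂ hy₁ hy₂ k hk
  have hp0 : (0 : ℝ) < p := by exact_mod_cast hp.pos
  have hp0' : (p : ℂ) ≠ 0 := by exact_mod_cast hp.ne_zero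
  have h := whittakerIntegral_heckeOperator_prime hϖ.continuous hϖ.left_invariant hp hpq
    (iota 1 p * (unip x₁₂ x₁₃ x₂₃ x₂₄ * iota y₁ y₂ * k))
  rw [heckeOperator_eq_heckeEigenvalue (hϖ.hecke p hp.pos hpq), whittakerIntegral_const_mul,
    iota_one_mul_iota_one_mul _ (by positivity) hp0, one_div, inv_mul_cancel₀ hp0.ne', iota_one_one,
    one_mul, iota_one_mul _ _ _ _ _ _ _ _ hp0 hy₁ hy₂,
    h₁ _ _ _ _ _ _ hy₁ (by positivity) k hk] at h
  simp only [Nat.cast_one, one_mul] at h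
  field_simp
  linear_combination -h

/-- At `ι(1, p^(r+2)) g` both known terms carry the same character value and the same `W_μ(y₁,
p^(r+2) y₂)`, so one can solve for `ϖ_{(1,p^(r+2))}`. The factor `p⁻⁴` is `p² p^(3r) / p^(3(r+2))`.
-/
theorem isWhittakerMultiple_prime_pow (hϖ : IsCuspidalEigenform q μ₁ μ₂ ϖ)
    (h₁ : IsWhittakerMultiple μ₁ μ₂ ϖ 1 1) {p : ℕ} (hp : p.Prime) (hpq : p.Coprime q) {r : ℕ}
    {b : ℂ} (hb : IsWhittakerMultiple μ₁ μ₂ ϖ (p ^ r) b) :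
    IsWhittakerMultiple μ₁ μ₂ ϖ (p ^ (r + 2))
      (heckeEigenvalue q (p ^ (r + 2)) ϖ / ((p ^ (r + 2) : ℕ) : ℂ) ^ 3 + b / (p : ℂ) ^ 4) := by
  intro x₁₂ x₁₃ x₂₃ x₂₄ y₁ y₂ hy₁ hy₂ k hk
  have hp0 : (0 : ℝ) < p := by exact_mod_cast hp.pos
  have hp0' : (p : ℂ) ≠ 0 := by exact_mod_cast hp.ne_zero
  have hP : (0 : ℝ) < (p ^ (r + 2) : ℕ) := by exact_mod_cast Nat.pow_pos hp.pos
  have h := whittakerIntegral_heckeOperator_prime_pow hϖ.continuous hϖ.left_invariant hp hpq r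
    (iota 1 (p ^ (r + 2) : ℕ) * (unip x₁₂ x₁₃ x₂₃ x₂₄ * iota y₁ y₂ * k))
  rw [heckeOperator_eq_heckeEigenvalue (hϖ.hecke _ (Nat.pow_pos hp.pos) (hpq.pow_left _)),
    whittakerIntegral_const_mul, iota_one_mul_iota_one_mul _ (by positivity) hP,
    iota_one_mul_iota_one_mul _ (by positivity) hP, one_div, inv_mul_cancel₀ hP.ne',
    div_mul_cancel₀ _ hP.ne', iota_one_one, one_mul, iota_one_mul _ _ _ _ _ _ _ _ hP hy₁ hy₂,
    iota_one_mul _ _ _ _ _ _ _ _ (by positivity) hy₁ hy₂,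
    h₁ _ _ _ _ _ _ hy₁ (by positivity) k hk, hb _ _ _ _ _ _ hy₁ (by positivity) k hk] at h
  have e₁ : ∀ x : ℝ, ((p ^ r : ℕ) : ℝ) * ((p : ℝ) ^ 2 * x) = (p ^ (r + 2) : ℕ) * x := fun x => by
    push_cast
    ring
  simp only [Nat.cast_one, one_mul, e₁] at h
  have hp2 : ((p ^ (r + 2) : ℕ) : ℂ) = (p ^ r : ℕ) * (p : ℂ) ^ 2 := by push_cast; ring
  have hp3 : ((p ^ r : ℕ) : ℂ) ≠ 0 := by exact_mod_cast (Nat.pow_pos hp.pos).ne'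
  generalize whittakerIntegral ϖ 1 (p ^ (r + 2)) _ = X at *
  generalize whittaker μ₁ μ₂ y₁ _ = W at *
  generalize addExp _ = E at *
  rw [hp2] at h ⊢
  field_simp
  linear_combination -h

theorem exists_isWhittakerMultiple_prime_pow (hϖ : IsCuspidalEigenform q μ₁ μ₂ ϖ)
    (h₁ : IsWhittakerMultiple μ₁ μ₂ ϖ 1 1) {p : ℕ} (hp : p.Prime) (hpq : p.Coprime q) (r : ℕ) :
    ∃ b, IsWhittakerMultiple μ₁ μ₂ ϖ (p ^ r) b := by
  induction r using Nat.twoStepInduction with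
  | zero => exact ⟨1, by rwa [pow_zero]⟩
  | one => exact ⟨_, by rw [pow_one]; exact isWhittakerMultiple_prime hϖ h₁ hp hpq⟩
  | more r ih _ =>
    obtain ⟨b, hb⟩ := ih
    exact ⟨_, isWhittakerMultiple_prime_pow hϖ h₁ hp hpq hb⟩

end

end SiegelHecke
end

/-! ### Conclusion: comparing the normalizations. -/

theorem mainTheorem6 (q : ℕ) (μ₁ μ₂ : ℂ) (ϖ : SiegelHecke.Sp4 → ℂ)
    (hϖ : SiegelHecke.IsCuspidalEigenform q μ₁ μ₂ ϖ)
    (hA : SiegelHecke.fourierCoeff μ₁ μ₂ ϖ 1 1 = 1)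
    (p : ℕ) (hp : p.Prime) (hpq : ¬ p ∣ q) :
    SiegelHecke.heckeEigenvalue q p ϖ =
        (((p : ℝ) ^ (3 / 2 : ℝ) : ℝ) : ℂ) * SiegelHecke.fourierCoeff μ₁ μ₂ ϖ 1 p ∧
      ∀ r : ℕ, 2 ≤ r →
        SiegelHecke.heckeEigenvalue q (p ^ r) ϖ =
          (((p : ℝ) ^ (3 * (r : ℝ) / 2) : ℝ) : ℂ) *
            (SiegelHecke.fourierCoeff μ₁ μ₂ ϖ 1 (p ^ r) -
              (p : ℂ)⁻¹ * SiegelHecke.fourierCoeff μ₁ μ₂ ϖ 1 (p ^ (r - 2))) := by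
  have hco : p.Coprime q := (hp.coprime_iff_not_dvd).2 hpq
  obtain ⟨h₁, hW⟩ := SiegelHecke.isFourierCoeff_one_one hA
  have h₁ : SiegelHecke.IsWhittakerMultiple μ₁ μ₂ ϖ 1 1 := by
    simpa using SiegelHecke.isFourierCoeff_one_iff.1 h₁
  have hp0 : (0 : ℝ) < p := by exact_mod_cast hp.pos
  have hp0' : (p : ℂ) ≠ 0 := by exact_mod_cast hp.ne_zero
  have hsq : ∀ s : ℕ, ((p : ℝ) ^ (3 * (s : ℝ) / 2)) * (p : ℝ) ^ (3 * (s : ℝ) / 2) =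
      ((p : ℝ) ^ s) ^ 3 := fun s => by
    rw [← Real.rpow_add hp0, add_halves, mul_comm, Real.rpow_mul hp0.le, Real.rpow_natCast]
    exact_mod_cast rfl
  have hpow : ∀ s : ℕ, (((p ^ s : ℕ) : ℝ)) ^ (3 / 2 : ℝ) = (p : ℝ) ^ (3 * (s : ℝ) / 2) :=
    fun s => by
      push_cast
      rw [← Real.rpow_natCast, ← Real.rpow_mul hp0.le]
      ring_nf
  refine ⟨?_, fun r hr => ?_⟩
  · rw [SiegelHecke.fourierCoeff_one_eq hp.pos hW
      (SiegelHecke.isWhittakerMultiple_prime hϖ h₁ hp hco)]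
    have h := hsq 1
    simp only [Nat.cast_one, mul_one, pow_one] at h
    have h' : (((p : ℝ) ^ (3 / 2 : ℝ) : ℝ) : ℂ) * (((p : ℝ) ^ (3 / 2 : ℝ) : ℝ) : ℂ) =
      (p : ℂ) ^ 3 := by exact_mod_cast h
    field_simp
    linear_combination -SiegelHecke.heckeEigenvalue q p ϖ * h'
  · obtain ⟨r, rfl⟩ := Nat.exists_eq_add_of_le' hr
    obtain ⟨b, hb⟩ := SiegelHecke.exists_isWhittakerMultiple_prime_pow hϖ h₁ hp hco r
    rw [Nat.add_sub_cancel, SiegelHecke.fourierCoeff_one_eq (Nat.pow_pos hp.pos) hW hb,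
      SiegelHecke.fourierCoeff_one_eq (Nat.pow_pos hp.pos) hW
        (SiegelHecke.isWhittakerMultiple_prime_pow hϖ h₁ hp hco hb), hpow, hpow]
    -- All half-integral powers are reduced to `R = p^(3r/2)`; its square is the cube of `p^r`,
    -- which leaves a rational identity.
    have hs : (p : ℝ) ^ (3 * ((r + 2 : ℕ) : ℝ) / 2) = (p : ℝ) ^ (3 * (r : ℝ) / 2) * p ^ 3 := by
      rw [← Real.rpow_natCast (p : ℝ) 3, ← Real.rpow_add hp0]
      congr 1
      push_cast
      ring
    have h := hsq r
    rw [hs]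
    generalize (p : ℝ) ^ (3 * (r : ℝ) / 2) = R at *
    have h' : (R : ℂ) * R = ((p : ℂ) ^ r) ^ 3 := by exact_mod_cast h
    have hpr : (p : ℂ) ^ r ≠ 0 := pow_ne_zero _ hp0'
    generalize SiegelHecke.heckeEigenvalue q (p ^ (r + 2)) ϖ = t
    push_cast
    rw [pow_add]
    generalize (p : ℂ) ^ r = P at *
    field_simp
    linear_combination -t * h'
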